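/- A \emph{$3\times3$ magilatin square} is a $3\times 3$ array of positive integers whose three row sums and three column sums are all equal and whose entries are distinct within each row and within each column (entries in different rows and columns may be equal). A \emph{reduced} magilatin square satisfies the same sum and distinctness conditions but has nonnegative integer entries with smallest entry $0$. A \emph{symmetry type} is an equivalence class under the symmetries generated by row permutations, column permutations and reflection in the main diagonal (transposition). For integers $t>0$ let $L_c(t)$ be the number of $3\times3$ magilatin squares all of whose entries lie in the open range $(0,t)$, and $\hat L_c(t)$ the number of symmetry types of such squares; let $R(t)$ and $\hat R(t)$ be the number of reduced $3\times3$ magilatin squares with largest entry $t$ and the number of their symmetry types. For a function $N$ of positive integers put $\mathbf N(x)=\sum_{t>0}N(t)x^t$. A function $N$ is a \emph{quasipolynomial} if for some $p\ge1$ there are polynomials $N_0,\dots,N_{p-1}$ (its \emph{constituents}) with $N(t)=N_{t\bmod p}(t)$ for all integers $t>0$; the least such $p$ is its \emph{period}. (1) The generating function of $L_c$ is \[ \mathbf L_c(x)=\frac{x^2}{(1-x)^2}\,\mathbf R(x)=\frac{12x^4\left(79x^{15}+190x^{14}+260x^{13}+250x^{12}+211x^{11}+179x^{10}+181x^{9}+198x^{8}+210x^{7}+181x^{6}+125x^{5}+61x^{4}+22x^{3}+8x^{2}+4x+1\right)}{(1-x^2)^2(1-x^3)^2(1-x^4)(1-x^5)}.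 \] (2) $L_c$ is a quasipolynomial of period exactly $60$, all of whose constituents have degree $5$. For every integer $t>0$, \[ L_c(t)=\tfrac{3}{10}t^5-\tfrac{51}{8}t^4+\tfrac{202}{3}t^3-c_2(t)\,t^2+c_1(t)\,t-c_0(t),\qquad c_2(t)=\begin{cases}\tfrac{3769}{10} & t\text{ even},\\ \tfrac{7493}{20} & t\text{ odd},\end{cases} \] where $c_1$ has least period $6$, with $c_1(t)=994$ for $t\equiv0,2$, $c_1(t)=986$ for $t\equiv4$, $c_1(t)=\tfrac{1909}2$ for $t\equiv1$ and $c_1(t)=\tfrac{1925}2$ for $t\equiv3,5\pmod 6$, and $c_0$ has least period $60$, with the following values (the entry in row $r$ and column $+k$ is $c_0(t)$ for $t\equiv r+k\pmod{60}$): \[ \begin{array}{r|cccccccccccc} r & +0 & +1 & +2 & +3 & +4 & +5 & +6 & +7 & +8 & +9 & +10 & +11 \\ \hline 0 & 948 & \tfrac{76933}{120} & \tfrac{2780}{3} & \tfrac{35607}{40} & \tfrac{13292}{15} & \tfrac{18433}{24} & \tfrac{4452}{5} & \tfrac{18497}{24} & \tfrac{14332}{15} & \tfrac{32727}{40} & \tfrac{2572}{3}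 & \tfrac{93893}{120} \\ 12 & 948 & \tfrac{87301}{120} & \tfrac{14332}{15} & \tfrac{6891}{8} & \tfrac{11996}{15} & \tfrac{18433}{24} & \tfrac{4884}{5} & \tfrac{95941}{120} & \tfrac{2780}{3} & \tfrac{29271}{40} & \tfrac{2572}{3} & \tfrac{104261}{120} \\ 24 & \tfrac{4884}{5} & \tfrac{16769}{24} & \tfrac{13036}{15} & \tfrac{6891}{8} & \tfrac{13292}{15} & \tfrac{95621}{120} & 948 & \tfrac{85573}{120} & \tfrac{2780}{3} & \tfrac{32727}{40} & \tfrac{13292}{15} & \tfrac{20161}{24} \\ 36 & \tfrac{4452}{5} & \tfrac{16769}{24} & \tfrac{14332}{15} & \tfrac{35607}{40} & \tfrac{2572}{3} & \tfrac{85253}{120} & 948 & \tfrac{95941}{120} & \tfrac{14332}{15} & \tfrac{6315}{8} & \tfrac{11996}{15} & \tfrac{20161}{24} \\ 48 & \tfrac{4884}{5} & \tfrac{87301}{120} & \tfrac{2780}{3} & \tfrac{32151}{40} & \tfrac{2572}{3} & \tfrac{95621}{120} & \tfrac{4884}{5} & \tfrac{18497}{24} & \tfrac{13036}{15} & \tfrac{6315}{8}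 & \tfrac{13292}{15} & \tfrac{104261}{120} \end{array} \] (3) The generating function of $\hat L_c$ is \[ \hat{\mathbf L}_c(x)=\frac{x^2}{(1-x)^2}\,\hat{\mathbf R}(x)=\frac{x^4\left(9x^{15}+20x^{14}+23x^{13}+16x^{12}+10x^{11}+13x^{10}+27x^{9}+43x^{8}+54x^{7}+52x^{6}+41x^{5}+25x^{4}+14x^{3}+8x^{2}+4x+1\right)}{(1-x^2)^2(1-x^3)^2(1-x^4)(1-x^5)}. \] (4) $\hat L_c$ is a quasipolynomial of period exactly $60$, all of whose constituents have degree $5$. For every integer $t>0$, \[ \hat L_c(t)=\tfrac1{240}t^5-\tfrac3{64}t^4+\tfrac{97}{216}t^3-\hat c_2(t)\,t^2+\hat c_1(t)\,t-\hat c_0(t),\qquad \hat c_2(t)=\begin{cases}\tfrac{2029}{720} & t\text{ even},\\ \tfrac{4013}{1440} & t\text{ odd},\end{cases} \] where $\hat c_1$ has least period $6$, with $\hat c_1(t)=\tfrac{17}2$ for $t\equiv0,2$, $\hat c_1(t)=\tfrac{151}{18}$ for $t\equiv4$, $\hat c_1(t)=\tfrac{1163}{144}$ for $t\equiv1$ and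 $\hat c_1(t)=\tfrac{131}{16}$ for $t\equiv3,5\pmod 6$, and $\hat c_0$ has least period $60$, with the following values (same layout): \[ \begin{array}{r|cccccccccccc} r & +0 & +1 & +2 & +3 & +4 & +5 & +6 & +7 & +8 & +9 & +10 & +11 \\ \hline 0 & 9 & \tfrac{49213}{8640} & \tfrac{235}{27} & \tfrac{2823}{320} & \tfrac{1144}{135} & \tfrac{12313}{1728} & \tfrac{41}{5} & \tfrac{12953}{1728} & \tfrac{1229}{135} & \tfrac{2503}{320} & \tfrac{218}{27} & \tfrac{63293}{8640} \\ 12 & 9 & \tfrac{59581}{8640} & \tfrac{1229}{135} & \tfrac{539}{64} & \tfrac{982}{135} & \tfrac{12313}{1728} & \tfrac{47}{5} & \tfrac{68221}{8640} & \tfrac{235}{27} & \tfrac{2119}{320} & \tfrac{218}{27} & \tfrac{73661}{8640} \\ 24 & \tfrac{47}{5} & \tfrac{11225}{1728} & \tfrac{1067}{135} & \tfrac{539}{64} & \tfrac{1144}{135} & \tfrac{65021}{8640} & 9 & \tfrac{57853}{8640} & \tfrac{235}{27} & \tfrac{2503}{320} & \tfrac{1144}{135} & \tfrac{14041}{1728}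 \\ 36 & \tfrac{41}{5} & \tfrac{11225}{1728} & \tfrac{1229}{135} & \tfrac{2823}{320} & \tfrac{218}{27} & \tfrac{54653}{8640} & 9 & \tfrac{68221}{8640} & \tfrac{1229}{135} & \tfrac{475}{64} & \tfrac{982}{135} & \tfrac{14041}{1728} \\ 48 & \tfrac{47}{5} & \tfrac{59581}{8640} & \tfrac{235}{27} & \tfrac{2439}{320} & \tfrac{218}{27} & \tfrac{65021}{8640} & \tfrac{47}{5} & \tfrac{12953}{1728} & \tfrac{1067}{135} & \tfrac{475}{64} & \tfrac{1144}{135} & \tfrac{73661}{8640} \end{array} \] -/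

import Mathlib

open PowerSeries in
/-- The generating function `∑_{t > 0} N(t) x^t` of a counting function `N`. -/
noncomputable def genFun (N : ℕ → ℕ) : PowerSeries ℚ :=
  PowerSeries.mk fun t => if t = 0 then 0 else (N t : ℚ)

/-- `N(t) = P_{t mod p}(t)` for all integers `t > 0`, where `P_0, …, P_{p-1}` are polynomials:
`N` is a quasipolynomial with constituents `P_0, …, P_{p-1}` (indexed by residues modulo `p`;
the values `P r` for `r ≥ p` are irrelevant). -/
def HasConstituents (N : ℕ → ℕ) (p : ℕ) (P : ℕ → Polynomial ℚ) : Prop :=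
  0 < p ∧ ∀ t : ℕ, 0 < t → (N t : ℚ) = (P (t % p)).eval (t : ℚ)

/-- `p` is the period of the quasipolynomial `N`: the least number of constituents. -/
def IsQuasiperiod (N : ℕ → ℕ) (p : ℕ) : Prop :=
  IsLeast {q : ℕ | ∃ P : ℕ → Polynomial ℚ, HasConstituents N q P} p

/-- `p` is the least positive period of the function `c`. -/
def HasMinimalPeriod (c : ℕ → ℚ) (p : ℕ) : Prop :=
  IsLeast {q : ℕ | 0 < q ∧ Function.Periodic c q} p

/-- The magilatin conditions on a `3 × 3` square of nonnegative integers: all row sums and all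
column sums equal one common value, and the entries are distinct within each row and within each
column. (Positivity is imposed in `magilatinSquares`; reduced squares contain the entry `0`.) -/
def IsMagilatin (A : Matrix (Fin 3) (Fin 3) ℕ) : Prop :=
  (∃ s : ℕ, (∀ i, ∑ j, A i j = s) ∧ (∀ j, ∑ i, A i j = s)) ∧
  (∀ i j k, j ≠ k → A i j ≠ A i k) ∧
  (∀ i j k, i ≠ k → A i j ≠ A k j)

/-- The `3 × 3` magilatin squares all of whose entries lie strictly between `0` and `t`. -/
def magilatinSquares (t : ℕ) : Set (Matrix (Fin 3) (Fin 3) ℕ) :=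
  {A | IsMagilatin A ∧ ∀ i j, 0 < A i j ∧ A i j < t}

/-- The reduced `3 × 3` magilatin squares (smallest entry `0`) with largest entry `w`. -/
def reducedMagilatinSquares (w : ℕ) : Set (Matrix (Fin 3) (Fin 3) ℕ) :=
  {A | IsMagilatin A ∧ (∃ i j, A i j = 0) ∧ (∃ i j, A i j = w) ∧ ∀ i j, A i j ≤ w}

/-- Equivalence of squares under the symmetries generated by row permutations, column permutations
and reflection in the main diagonal; every product of these is a row permutation and a column
permutation, applied either to the square itself or to its transpose. -/
def squareSetoid : Setoid (Matrix (Fin 3) (Fin 3) ℕ) where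
  r A B := ∃ σ τ : Equiv.Perm (Fin 3),
    B = A.submatrix σ τ ∨ B = A.transpose.submatrix σ τ
  iseqv := by
    refine ⟨fun A => ⟨1, 1, Or.inl rfl⟩, ?_, ?_⟩
    · rintro A B ⟨σ, τ, h | h⟩
      · refine ⟨σ⁻¹, τ⁻¹, Or.inl ?_⟩
        subst h; ext i j; simp
      · refine ⟨τ⁻¹, σ⁻¹, Or.inr ?_⟩
        subst h; ext i j; simp
    · rintro A B C ⟨σ, τ, h | h⟩ ⟨σ', τ', h' | h'⟩
      · exact ⟨σ * σ', τ * τ', Or.inl (by subst h; subst h'; rfl)⟩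
      · exact ⟨τ * σ', σ * τ', Or.inr (by subst h; subst h'; rfl)⟩
      · exact ⟨σ * σ', τ * τ', Or.inr (by subst h; subst h'; rfl)⟩
      · exact ⟨τ * σ', σ * τ', Or.inl (by subst h; subst h'; rfl)⟩

/-- The number of symmetry types (symmetry classes) represented in a set of squares. -/
noncomputable def numSymmetryTypes (S : Set (Matrix (Fin 3) (Fin 3) ℕ)) : ℕ :=
  (Quotient.mk squareSetoid '' S).ncard

/-- `L_c(t)`: the number of magilatin squares with entries in the open range `(0, t)`. -/
noncomputable def magilatinCount (t : ℕ) : ℕ := (magilatinSquares t).ncard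

/-- The number of reduced magilatin squares with largest entry `w`. -/
noncomputable def reducedMagilatinCount (w : ℕ) : ℕ := (reducedMagilatinSquares w).ncard

/-- `L̂_c(t)`: the number of symmetry types of magilatin squares with entries in `(0, t)`. -/
noncomputable def magilatinTypeCount (t : ℕ) : ℕ := numSymmetryTypes (magilatinSquares t)

/-- The number of symmetry types of reduced magilatin squares with largest entry `w`. -/
noncomputable def reducedMagilatinTypeCount (w : ℕ) : ℕ :=
  numSymmetryTypes (reducedMagilatinSquares w)

/-- `c_1(t)`, given by `t mod 6`. -/
def magilatinC1 (t : ℕ) : ℚ :=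
  ([994, 1909 / 2, 994, 1925 / 2, 986, 1925 / 2] : List ℚ).getD (t % 6) 0

/-- `c_0(t)`, given by `t mod 60`. -/
def magilatinC0 (t : ℕ) : ℚ :=
  ([
    948, 76933 / 120, 2780 / 3, 35607 / 40, 13292 / 15, 18433 / 24,
    4452 / 5, 18497 / 24, 14332 / 15, 32727 / 40, 2572 / 3, 93893 / 120,
    948, 87301 / 120, 14332 / 15, 6891 / 8, 11996 / 15, 18433 / 24,
    4884 / 5, 95941 / 120, 2780 / 3, 29271 / 40, 2572 / 3, 104261 / 120,
    4884 / 5, 16769 / 24, 13036 / 15, 6891 / 8, 13292 / 15, 95621 / 120,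
    948, 85573 / 120, 2780 / 3, 32727 / 40, 13292 / 15, 20161 / 24,
    4452 / 5, 16769 / 24, 14332 / 15, 35607 / 40, 2572 / 3, 85253 / 120,
    948, 95941 / 120, 14332 / 15, 6315 / 8, 11996 / 15, 20161 / 24,
    4884 / 5, 87301 / 120, 2780 / 3, 32151 / 40, 2572 / 3, 95621 / 120,
    4884 / 5, 18497 / 24, 13036 / 15, 6315 / 8, 13292 / 15, 104261 / 120 ] : List ℚ).getD (t % 60) 0

/-- `ĉ_1(t)`, given by `t mod 6`. -/
def magilatinTypeC1 (t : ℕ) : ℚ :=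
  ([17 / 2, 1163 / 144, 17 / 2, 131 / 16, 151 / 18, 131 / 16] : List ℚ).getD (t % 6) 0

/-- `ĉ_0(t)`, given by `t mod 60`. -/
def magilatinTypeC0 (t : ℕ) : ℚ :=
  ([
    9, 49213 / 8640, 235 / 27, 2823 / 320, 1144 / 135, 12313 / 1728,
    41 / 5, 12953 / 1728, 1229 / 135, 2503 / 320, 218 / 27, 63293 / 8640,
    9, 59581 / 8640, 1229 / 135, 539 / 64, 982 / 135, 12313 / 1728,
    47 / 5, 68221 / 8640, 235 / 27, 2119 / 320, 218 / 27, 73661 / 8640,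
    47 / 5, 11225 / 1728, 1067 / 135, 539 / 64, 1144 / 135, 65021 / 8640,
    9, 57853 / 8640, 235 / 27, 2503 / 320, 1144 / 135, 14041 / 1728,
    41 / 5, 11225 / 1728, 1229 / 135, 2823 / 320, 218 / 27, 54653 / 8640,
    9, 68221 / 8640, 1229 / 135, 475 / 64, 982 / 135, 14041 / 1728,
    47 / 5, 59581 / 8640, 235 / 27, 2439 / 320, 218 / 27, 65021 / 8640,
    47 / 5, 12953 / 1728, 1067 / 135, 475 / 64, 1144 / 135, 73661 / 8640 ] : List ℚ).getD (t % 60) 0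

open Polynomial in
/-- The stated constituent of `L_c` for `t ≡ r (mod 60)`. -/
noncomputable def magilatinConstituent (r : ℕ) : Polynomial ℚ :=
  C (3 / 10) * X ^ 5 - C (51 / 8) * X ^ 4 + C (202 / 3) * X ^ 3
    - C (if Even r then 3769 / 10 else 7493 / 20) * X ^ 2
    + C (magilatinC1 r) * X - C (magilatinC0 r)

open Polynomial in
/-- The stated constituent of `L̂_c` for `t ≡ r (mod 60)`. -/
noncomputable def magilatinTypeConstituent (r : ℕ) : Polynomial ℚ :=
  C (1 / 240) * X ^ 5 - C (3 / 64) * X ^ 4 + C (97 / 216) * X ^ 3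
    - C (if Even r then 2029 / 720 else 4013 / 1440) * X ^ 2
    + C (magilatinTypeC1 r) * X - C (magilatinTypeC0 r)

/-! Up to symmetry a least entry m stands in the corner. The line sums then express the whole square
through m and the complementary minor, giving `cornerSquare m p q r s`. Row and column swaps fixing
the corner, and transposition, permute p, q, r, s. Sorting them to q ≤ p, s ≤ r, r < p picks exactly
one representative per symmetry type (`exists_equiv_normal`, `IsNormal.unique`). Its largest entry
is m + p + r, so the range is w = p + r. The class has 12, 36 or 72 members
(`IsNormal.card_symmetryClass`).

Adding a constant to all entries changes neither the conditions nor the class sizes, and a range w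
leaves t - 1 - w possible least entries in (0, t). Hence the count is the sum of (t - 1 - w) R(w)
over w < t, for squares and for types alike (`magilatinCount_eq`, `magilatinTypeCount_eq`). Its
second difference is R, which is the factor x²/(1 - x)².

For fixed p, r, s the distinctness conditions only remove from 0, ..., p the values of q in a set of
at most six elements (`isNormal_iff`). Its size depends on a few linear coincidences among p, r, s.
Summing over s, and then over r with p = w - r, gives closed forms with floors and congruences
modulo 2, 3 and 5 (`six_mul_card_normalTriples`, `rangeCount_eq`).

The stated quasipolynomials have these closed forms as second differences and vanish at t = 1, 2, so
they are the counts. On each residue class modulo 60 the difference of the two sides is a cubic,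
settled by four evaluations. In the same way the recurrence given by the denominator of the
generating function reduces to six evaluations per class. It leaves only finitely many numerator
coefficients. The period is exactly 60 because constituents are unique and their constant terms have
least period 60. -/

/-! ### Corner squares and normal forms -/

/-- The square with smallest entry `m` at the top left whose complementary minor is
`m + !![q, r; s, p]`. -/
def cornerSquare (m p q r s : ℕ) : Matrix (Fin 3) (Fin 3) ℕ :=
  !![m, m + p + r, m + q + s; m + p + s, m + q, m + r; m + q + r, m + s, m + p]

/-- The distinctness conditions on `cornerSquare m p q r s`. -/
def CornerDistinct (p q r s : ℕ) : Prop :=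
  0 < p + r ∧ 0 < q + s ∧ p + r ≠ q + s ∧ p + s ≠ q ∧ p + s ≠ r ∧ q ≠ r ∧
  q + r ≠ s ∧ q + r ≠ p ∧ s ≠ p ∧ 0 < p + s ∧ 0 < q + r ∧ p + s ≠ q + r ∧
  p + r ≠ q ∧ p + r ≠ s ∧ q ≠ s ∧ q + s ≠ r ∧ q + s ≠ p ∧ r ≠ p

lemma isMagilatin_cornerSquare_iff (m p q r s : ℕ) :
    IsMagilatin (cornerSquare m p q r s) ↔ CornerDistinct p q r s := by
  constructor
  · rintro ⟨-, h1, h2⟩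
    have a1 := h1 0 0 1 (by decide)
    have a2 := h1 0 0 2 (by decide)
    have a3 := h1 0 1 2 (by decide)
    have a4 := h1 1 0 1 (by decide)
    have a5 := h1 1 0 2 (by decide)
    have a6 := h1 1 1 2 (by decide)
    have a7 := h1 2 0 1 (by decide)
    have a8 := h1 2 0 2 (by decide)
    have a9 := h1 2 1 2 (by decide)
    have b1 := h2 0 0 1 (by decide)
    have b2 := h2 0 0 2 (by decide)
    have b3 := h2 1 0 2 (by decide)
    have b4 := h2 0 1 1 (by decide)
    have b5 := h2 0 1 2 (by decide)
    have b6 := h2 1 1 2 (by decide)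
    have b7 := h2 0 2 1 (by decide)
    have b8 := h2 0 2 2 (by decide)
    have b9 := h2 1 2 2 (by decide)
    simp [cornerSquare] at a1 a2 a3 a4 a5 a6 a7 a8 a9 b1 b2 b3 b4 b5 b6 b7 b8 b9
    unfold CornerDistinct
    omega
  · intro h
    unfold CornerDistinct at h
    refine ⟨⟨m + m + m + p + q + r + s, ?_, ?_⟩, ?_, ?_⟩
    · intro i
      fin_cases i <;> simp [cornerSquare, Fin.sum_univ_three] <;> ring
    · intro i
      fin_cases i <;> simp [cornerSquare, Fin.sum_univ_three] <;> ring
    · intro i j k hjk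
      fin_cases i <;> fin_cases j <;> fin_cases k <;> simp [cornerSquare] at hjk ⊢ <;> omega
    · intro i j k hjk
      fin_cases i <;> fin_cases k <;> fin_cases j <;> simp [cornerSquare] at hjk ⊢ <;> omega

lemma IsMagilatin.transpose {A : Matrix (Fin 3) (Fin 3) ℕ} (h : IsMagilatin A) :
    IsMagilatin A.transpose := by
  obtain ⟨⟨s, h1, h2⟩, h3, h4⟩ := h
  exact ⟨⟨s, h2, h1⟩, fun i j k hjk => h4 j i k hjk, fun i j k hjk => h3 j i k hjk⟩

lemma IsMagilatin.submatrix {A : Matrix (Fin 3) (Fin 3) ℕ} (h : IsMagilatin A)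
    (σ τ : Equiv.Perm (Fin 3)) : IsMagilatin (A.submatrix σ τ) := by
  obtain ⟨⟨s, h1, h2⟩, h3, h4⟩ := h
  refine ⟨⟨s, fun i => ?_, fun j => ?_⟩, fun i j k hjk => ?_, fun i j k hjk => ?_⟩
  · rw [← h1 (σ i)]
    exact Equiv.sum_comp τ (fun j => A (σ i) j)
  · rw [← h2 (τ j)]
    exact Equiv.sum_comp σ (fun i => A i (τ j))
  · exact h3 _ _ _ (fun e => hjk (τ.injective e))
  · exact h4 _ _ _ (fun e => hjk (σ.injective e))

lemma IsMagilatin.of_equiv {A B : Matrix (Fin 3) (Fin 3) ℕ} (h : IsMagilatin A)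
    (e : squareSetoid.r A B) : IsMagilatin B := by
  obtain ⟨σ, τ, rfl | rfl⟩ := e
  · exact h.submatrix σ τ
  · exact h.transpose.submatrix σ τ

lemma forall_entries_of_equiv {A B : Matrix (Fin 3) (Fin 3) ℕ} (e : squareSetoid.r A B)
    {P : ℕ → Prop} (h : ∀ i j, P (A i j)) : ∀ i j, P (B i j) := by
  obtain ⟨σ, τ, rfl | rfl⟩ := e
  · exact fun i j => h _ _
  · exact fun i j => h _ _

lemma exists_entry_of_equiv {A B : Matrix (Fin 3) (Fin 3) ℕ} (e : squareSetoid.r A B)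
    {P : ℕ → Prop} (h : ∃ i j, P (A i j)) : ∃ i j, P (B i j) := by
  by_contra hB
  push Not at hB
  obtain ⟨i, j, hij⟩ := h
  exact forall_entries_of_equiv (squareSetoid.symm e) (P := fun x => ¬ P x) hB i j hij

lemma perm_fin_three_cases (σ : Equiv.Perm (Fin 3)) :
    (σ 0 = 0 ∧ σ 1 = 1 ∧ σ 2 = 2) ∨ (σ 0 = 0 ∧ σ 1 = 2 ∧ σ 2 = 1) ∨
    (σ 0 = 1 ∧ σ 1 = 0 ∧ σ 2 = 2) ∨ (σ 0 = 1 ∧ σ 1 = 2 ∧ σ 2 = 0) ∨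
    (σ 0 = 2 ∧ σ 1 = 0 ∧ σ 2 = 1) ∨ (σ 0 = 2 ∧ σ 1 = 1 ∧ σ 2 = 0) := by
  revert σ
  decide

lemma perm_fin_three_ext {σ τ : Equiv.Perm (Fin 3)} (h0 : σ 0 = τ 0) (h1 : σ 1 = τ 1)
    (h2 : σ 2 = τ 2) : σ = τ := by
  ext i
  fin_cases i
  · exact congrArg Fin.val h0
  · exact congrArg Fin.val h1
  · exact congrArg Fin.val h2

lemma matrix_fin_three_ext_iff {A B : Matrix (Fin 3) (Fin 3) ℕ} :
    A = B ↔ (A 0 0 = B 0 0 ∧ A 0 1 = B 0 1 ∧ A 0 2 = B 0 2) ∧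
      (A 1 0 = B 1 0 ∧ A 1 1 = B 1 1 ∧ A 1 2 = B 1 2) ∧
      (A 2 0 = B 2 0 ∧ A 2 1 = B 2 1 ∧ A 2 2 = B 2 2) := by
  constructor
  · rintro rfl; simp
  · rintro ⟨⟨_, _, _⟩, ⟨_, _, _⟩, ⟨_, _, _⟩⟩
    ext i j
    fin_cases i <;> fin_cases j <;> assumption

lemma cornerSquare_swap_rows (m p q r s : ℕ) :
    squareSetoid.r (cornerSquare m p q r s) (cornerSquare m r s p q) := by
  refine ⟨Equiv.swap 1 2, 1, Or.inl ?_⟩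
  rw [matrix_fin_three_ext_iff]
  simp [cornerSquare, Equiv.swap_apply_def]
  omega

lemma cornerSquare_swap_columns (m p q r s : ℕ) :
    squareSetoid.r (cornerSquare m p q r s) (cornerSquare m s r q p) := by
  refine ⟨1, Equiv.swap 1 2, Or.inl ?_⟩
  rw [matrix_fin_three_ext_iff]
  simp [cornerSquare, Equiv.swap_apply_def]
  omega

lemma cornerSquare_transpose (m p q r s : ℕ) :
    squareSetoid.r (cornerSquare m p q r s) (cornerSquare m p q s r) := by
  refine ⟨1, 1, Or.inr ?_⟩
  rw [matrix_fin_three_ext_iff]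
  simp [cornerSquare]

/-- Each symmetry type of magilatin squares contains exactly one `cornerSquare m p q r s`
with parameters ordered in this way. -/
def IsNormal (p q r s : ℕ) : Prop :=
  q ≤ p ∧ s ≤ r ∧ r < p ∧ CornerDistinct p q r s

/-- Two swaps bring a least entry to the corner. The common line sum is then the sum of the
complementary minor minus that entry, so the minor determines the remaining four entries. -/
lemma exists_equiv_cornerSquare {A : Matrix (Fin 3) (Fin 3) ℕ} (h : IsMagilatin A) :
    ∃ m p q r s, squareSetoid.r A (cornerSquare m p q r s) := by
  obtain ⟨⟨i, j⟩, hij⟩ := Finite.exists_min (fun x : Fin 3 × Fin 3 => A x.1 x.2)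
  set B := A.submatrix (Equiv.swap 0 i) (Equiv.swap 0 j) with hB
  have hAB : squareSetoid.r A B := ⟨_, _, Or.inl rfl⟩
  have hmin : ∀ k l, B 0 0 ≤ B k l := fun k l => by
    have := hij (Equiv.swap 0 i k, Equiv.swap 0 j l)
    simpa [hB] using this
  obtain ⟨⟨s, h1, h2⟩, -⟩ := h.of_equiv hAB
  obtain ⟨p, hp⟩ := Nat.exists_eq_add_of_le (hmin 2 2)
  obtain ⟨q, hq⟩ := Nat.exists_eq_add_of_le (hmin 1 1)
  obtain ⟨r, hr⟩ := Nat.exists_eq_add_of_le (hmin 1 2)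
  obtain ⟨t, ht⟩ := Nat.exists_eq_add_of_le (hmin 2 1)
  refine ⟨B 0 0, p, q, r, t, ?_⟩
  convert hAB using 1
  have e0 := h1 0
  have e1 := h1 1
  have e2 := h1 2
  have f0 := h2 0
  have f1 := h2 1
  have f2 := h2 2
  simp only [Fin.sum_univ_three] at e0 e1 e2 f0 f1 f2
  rw [matrix_fin_three_ext_iff]
  simp only [cornerSquare, Matrix.of_apply, Matrix.cons_val', Matrix.cons_val_zero,
    Matrix.cons_val_one, Matrix.cons_val, true_and]
  omega

lemma exists_equiv_normal {A : Matrix (Fin 3) (Fin 3) ℕ} (h : IsMagilatin A) :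
    ∃ m p q r s, IsNormal p q r s ∧ squareSetoid.r A (cornerSquare m p q r s) := by
  obtain ⟨m, p, q, r, s, e⟩ := exists_equiv_cornerSquare h
  have sort₁ : ∃ p q r s, q ≤ p ∧ squareSetoid.r A (cornerSquare m p q r s) := by
    rcases le_total q p with hqp | hqp
    · exact ⟨p, q, r, s, hqp, e⟩
    · exact ⟨q, p, s, r, hqp, squareSetoid.trans e
        (squareSetoid.trans (cornerSquare_swap_rows ..) (cornerSquare_swap_columns ..))⟩
  obtain ⟨p, q, r, s, hqp, e⟩ := sort₁
  have sort₂ : ∃ p q r s, q ≤ p ∧ s ≤ r ∧ squareSetoid.r A (cornerSquare m p q r s) := by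
    rcases le_total s r with hsr | hsr
    · exact ⟨p, q, r, s, hqp, hsr, e⟩
    · exact ⟨p, q, s, r, hqp, hsr, squareSetoid.trans e (cornerSquare_transpose ..)⟩
  obtain ⟨p, q, r, s, hqp, hsr, e⟩ := sort₂
  have hd := (isMagilatin_cornerSquare_iff m p q r s).1 (h.of_equiv e)
  rcases Nat.lt_trichotomy r p with hrp | hrp | hrp
  · exact ⟨m, p, q, r, s, ⟨hqp, hsr, hrp, hd⟩, e⟩
  · unfold CornerDistinct at hd
    omega
  · have e' := squareSetoid.trans e (cornerSquare_swap_rows ..)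
    exact ⟨m, r, s, p, q, ⟨hsr, hqp, hrp,
      (isMagilatin_cornerSquare_iff _ _ _ _ _).1 (h.of_equiv e')⟩, e'⟩

/-- The least entry may occur several times, so a symmetry between two normal forms need not fix the
corner. All 72 symmetries are therefore examined; each yields a linear system. -/
lemma IsNormal.unique {m p q r s m' p' q' r' s' : ℕ} (h : IsNormal p q r s)
    (h' : IsNormal p' q' r' s')
    (e : squareSetoid.r (cornerSquare m p q r s) (cornerSquare m' p' q' r' s')) :
    m = m' ∧ p = p' ∧ q = q' ∧ r = r' ∧ s = s' := by
  obtain ⟨σ, τ, e | e⟩ := e <;> rw [matrix_fin_three_ext_iff] at e <;>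
  simp only [Matrix.submatrix_apply, Matrix.transpose_apply] at e <;>
  unfold IsNormal CornerDistinct at h h' <;>
  rcases perm_fin_three_cases σ with ⟨h0, h1, h2⟩ | ⟨h0, h1, h2⟩ | ⟨h0, h1, h2⟩ |
    ⟨h0, h1, h2⟩ | ⟨h0, h1, h2⟩ | ⟨h0, h1, h2⟩ <;>
  rcases perm_fin_three_cases τ with ⟨k0, k1, k2⟩ | ⟨k0, k1, k2⟩ | ⟨k0, k1, k2⟩ |
    ⟨k0, k1, k2⟩ | ⟨k0, k1, k2⟩ | ⟨k0, k1, k2⟩ <;>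
  rw [h0, h1, h2, k0, k1, k2] at e <;>
  simp only [cornerSquare, Matrix.of_apply, Matrix.cons_val', Matrix.cons_val_zero,
    Matrix.cons_val_one, Matrix.cons_val] at e <;>
  omega

/-! ### Sizes of symmetry classes -/

open Classical in
/-- The squares equivalent to `A`. -/
noncomputable def symmetryClass (A : Matrix (Fin 3) (Fin 3) ℕ) :
    Finset (Matrix (Fin 3) (Fin 3) ℕ) :=
  Finset.univ.image (fun x : Equiv.Perm (Fin 3) × Equiv.Perm (Fin 3) => A.submatrix x.1 x.2) ∪
  Finset.univ.image
    (fun x : Equiv.Perm (Fin 3) × Equiv.Perm (Fin 3) => A.transpose.submatrix x.1 x.2)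

lemma mem_symmetryClass {A B : Matrix (Fin 3) (Fin 3) ℕ} :
    B ∈ symmetryClass A ↔ squareSetoid.r A B := by
  simp only [symmetryClass, Finset.mem_union, Finset.mem_image, Finset.mem_univ, true_and,
    Prod.exists]
  constructor
  · rintro (⟨σ, τ, rfl⟩ | ⟨σ, τ, rfl⟩)
    · exact ⟨σ, τ, Or.inl rfl⟩
    · exact ⟨σ, τ, Or.inr rfl⟩
  · rintro ⟨σ, τ, rfl | rfl⟩
    · exact Or.inl ⟨σ, τ, rfl⟩
    · exact Or.inr ⟨σ, τ, rfl⟩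

lemma submatrix_eq_submatrix_iff {A B : Matrix (Fin 3) (Fin 3) ℕ}
    {σ τ σ' τ' : Equiv.Perm (Fin 3)} :
    A.submatrix σ τ = B.submatrix σ' τ' ↔ A.submatrix (σ * σ'⁻¹) (τ * τ'⁻¹) = B := by
  constructor
  · intro h
    have := congrArg (fun M => Matrix.submatrix M (σ'⁻¹ : Equiv.Perm (Fin 3))
      (τ'⁻¹ : Equiv.Perm (Fin 3))) h
    ext i j
    simpa using congrFun (congrFun this i) j
  · rintro rfl
    ext i j
    simp

lemma submatrix_injective_of_stabilizer {A : Matrix (Fin 3) (Fin 3) ℕ}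
    (h : ∀ σ τ : Equiv.Perm (Fin 3), A.submatrix σ τ = A → σ = 1 ∧ τ = 1) :
    Function.Injective
      (fun x : Equiv.Perm (Fin 3) × Equiv.Perm (Fin 3) => A.submatrix x.1 x.2) := by
  rintro ⟨σ, τ⟩ ⟨σ', τ'⟩ e
  obtain ⟨h1, h2⟩ := h _ _ (submatrix_eq_submatrix_iff.1 e)
  rw [mul_inv_eq_one] at h1 h2
  exact Prod.ext h1 h2

lemma transpose_stabilizer {A : Matrix (Fin 3) (Fin 3) ℕ}
    (h : ∀ σ τ : Equiv.Perm (Fin 3), A.submatrix σ τ = A → σ = 1 ∧ τ = 1) :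
    ∀ σ τ : Equiv.Perm (Fin 3), A.transpose.submatrix σ τ = A.transpose → σ = 1 ∧ τ = 1 := by
  intro σ τ e
  exact (h τ σ (by simpa using congrArg Matrix.transpose e)).symm

lemma card_perm_prod_perm :
    (Finset.univ : Finset (Equiv.Perm (Fin 3) × Equiv.Perm (Fin 3))).card = 36 := by
  simp [Fintype.card_perm, Nat.factorial]

lemma card_symmetryClass_eq_36 {A : Matrix (Fin 3) (Fin 3) ℕ}
    (h : ∀ σ τ : Equiv.Perm (Fin 3), A.submatrix σ τ = A → σ = 1 ∧ τ = 1)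
    (h' : ∃ σ τ : Equiv.Perm (Fin 3), A.submatrix σ τ = A.transpose) :
    (symmetryClass A).card = 36 := by
  classical
  rw [symmetryClass, Finset.union_eq_left.2, Finset.card_image_of_injective _
    (submatrix_injective_of_stabilizer h), card_perm_prod_perm]
  intro B hB
  obtain ⟨σ₀, τ₀, e⟩ := h'
  simp only [Finset.mem_image, Finset.mem_univ, true_and, Prod.exists] at hB ⊢
  obtain ⟨σ, τ, rfl⟩ := hB
  exact ⟨σ₀ * σ, τ₀ * τ, by rw [← e]; rfl⟩

/-- The permutation orbits of the square and of its transpose have 36 elements each; a common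
element would make the transpose a permutation of the square. -/
lemma card_symmetryClass_eq_72 {A : Matrix (Fin 3) (Fin 3) ℕ}
    (h : ∀ σ τ : Equiv.Perm (Fin 3), A.submatrix σ τ = A → σ = 1 ∧ τ = 1)
    (h' : ∀ σ τ : Equiv.Perm (Fin 3), A.submatrix σ τ ≠ A.transpose) :
    (symmetryClass A).card = 72 := by
  classical
  rw [symmetryClass, Finset.card_union_of_disjoint, Finset.card_image_of_injective _
    (submatrix_injective_of_stabilizer h), Finset.card_image_of_injective _
    (submatrix_injective_of_stabilizer (transpose_stabilizer h)), card_perm_prod_perm]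
  rw [Finset.disjoint_left]
  intro B hB hB'
  simp only [Finset.mem_image, Finset.mem_univ, true_and, Prod.exists] at hB hB'
  obtain ⟨σ, τ, rfl⟩ := hB
  obtain ⟨σ', τ', e⟩ := hB'
  exact h' _ _ (submatrix_eq_submatrix_iff.1 e.symm)

lemma IsNormal.stabilizer {m p q r s : ℕ} (h : IsNormal p q r s) (hr : r ≠ 0)
    (σ τ : Equiv.Perm (Fin 3))
    (e : (cornerSquare m p q r s).submatrix σ τ = cornerSquare m p q r s) :
    σ = 1 ∧ τ = 1 := by
  rw [matrix_fin_three_ext_iff] at e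
  simp only [Matrix.submatrix_apply] at e
  unfold IsNormal CornerDistinct at h
  rcases perm_fin_three_cases σ with ⟨h0, h1, h2⟩ | ⟨h0, h1, h2⟩ | ⟨h0, h1, h2⟩ |
    ⟨h0, h1, h2⟩ | ⟨h0, h1, h2⟩ | ⟨h0, h1, h2⟩ <;>
  rcases perm_fin_three_cases τ with ⟨k0, k1, k2⟩ | ⟨k0, k1, k2⟩ | ⟨k0, k1, k2⟩ |
    ⟨k0, k1, k2⟩ | ⟨k0, k1, k2⟩ | ⟨k0, k1, k2⟩ <;>
  first
  | exact ⟨perm_fin_three_ext h0 h1 h2, perm_fin_three_ext k0 k1 k2⟩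
  | (exfalso
     rw [h0, h1, h2, k0, k1, k2] at e
     simp only [cornerSquare, Matrix.of_apply, Matrix.cons_val', Matrix.cons_val_zero,
       Matrix.cons_val_one, Matrix.cons_val] at e
     omega)

lemma IsNormal.submatrix_ne_transpose {m p q r s : ℕ} (h : IsNormal p q r s) (hs : s ≠ 0)
    (hq : q ≠ 0) (hpq : p ≠ q) (hrs : r ≠ s) (σ τ : Equiv.Perm (Fin 3)) :
    (cornerSquare m p q r s).submatrix σ τ ≠ (cornerSquare m p q r s).transpose := by
  intro e
  rw [matrix_fin_three_ext_iff] at e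
  simp only [Matrix.submatrix_apply, Matrix.transpose_apply] at e
  unfold IsNormal CornerDistinct at h
  rcases perm_fin_three_cases σ with ⟨h0, h1, h2⟩ | ⟨h0, h1, h2⟩ | ⟨h0, h1, h2⟩ |
    ⟨h0, h1, h2⟩ | ⟨h0, h1, h2⟩ | ⟨h0, h1, h2⟩ <;>
  rcases perm_fin_three_cases τ with ⟨k0, k1, k2⟩ | ⟨k0, k1, k2⟩ | ⟨k0, k1, k2⟩ |
    ⟨k0, k1, k2⟩ | ⟨k0, k1, k2⟩ | ⟨k0, k1, k2⟩ <;>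
  rw [h0, h1, h2, k0, k1, k2] at e <;>
  simp only [cornerSquare, Matrix.of_apply, Matrix.cons_val', Matrix.cons_val_zero,
    Matrix.cons_val_one, Matrix.cons_val] at e <;>
  omega

lemma exists_submatrix_eq_transpose {m p q r s : ℕ} (h : s = 0 ∨ q = 0 ∨ p = q ∨ r = s) :
    ∃ σ τ : Equiv.Perm (Fin 3),
      (cornerSquare m p q r s).submatrix σ τ = (cornerSquare m p q r s).transpose := by
  rcases h with rfl | rfl | rfl | rfl
  -- For s = 0 the least entry also stands at position (2, 1); these rotations move that occurrence
  -- to the corner and produce the transpose.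
  · refine ⟨(finRotate 3)⁻¹, finRotate 3, ?_⟩
    have e0 : (finRotate 3)⁻¹ 0 = 2 := by decide
    have e1 : (finRotate 3)⁻¹ 1 = 0 := by decide
    have e2 : (finRotate 3)⁻¹ 2 = 1 := by decide
    have f0 : finRotate 3 0 = 1 := by decide
    have f1 : finRotate 3 1 = 2 := by decide
    have f2 : finRotate 3 2 = 0 := by decide
    rw [matrix_fin_three_ext_iff]
    simp only [Matrix.submatrix_apply, e0, e1, e2, f0, f1, f2]
    simp [cornerSquare]
  · refine ⟨Equiv.swap 0 1, Equiv.swap 0 1, ?_⟩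
    rw [matrix_fin_three_ext_iff]
    simp [cornerSquare, Equiv.swap_apply_def]
  · refine ⟨Equiv.swap 1 2, Equiv.swap 1 2, ?_⟩
    rw [matrix_fin_three_ext_iff]
    simp [cornerSquare, Equiv.swap_apply_def]
  · refine ⟨1, 1, ?_⟩
    rw [matrix_fin_three_ext_iff]
    simp [cornerSquare]

/-- For r = s = 0 the entry at (i, j) depends only on i + j modulo 3, so rotating rows amounts to
rotating columns. -/
lemma cornerSquare_cyclic (m p q : ℕ) (i j c : Fin 3) :
    cornerSquare m p q 0 0 (i + c) j = cornerSquare m p q 0 0 i (c + j) := by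
  fin_cases i <;> fin_cases j <;> fin_cases c <;> rfl

/-- The square is symmetric, and row rotations can be absorbed into column permutations. What
remains is 2 cosets of rotations times 6 column permutations, and distinctness within lines
separates these 12 images. -/
lemma card_symmetryClass_eq_12 {m p q : ℕ} (h : IsNormal p q 0 0) :
    (symmetryClass (cornerSquare m p q 0 0)).card = 12 := by
  classical
  set A := cornerSquare m p q 0 0 with hA
  have hmag : IsMagilatin A := (isMagilatin_cornerSquare_iff ..).2 h.2.2.2
  obtain ⟨-, hrow, hcol⟩ := hmag
  have ht : A.transpose = A := by
    rw [matrix_fin_three_ext_iff]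
    simp [hA, cornerSquare]
  have hone : (1 : Equiv.Perm (Fin 3)) ≠ Equiv.swap 1 2 := by decide
  have hσ : ∀ σ : Equiv.Perm (Fin 3), ∃ σ' ∈ ({1, Equiv.swap 1 2} : Finset (Equiv.Perm (Fin 3))),
      ∃ c : Fin 3, ∀ i, σ i = σ' i + c := by decide
  have himage : symmetryClass A = (({1, Equiv.swap 1 2} : Finset (Equiv.Perm (Fin 3))) ×ˢ
      (Finset.univ : Finset (Equiv.Perm (Fin 3)))).image (fun x => A.submatrix x.1 x.2) := by
    rw [symmetryClass, ht, Finset.union_self]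
    apply Finset.Subset.antisymm
    · intro B hB
      simp only [Finset.mem_image, Finset.mem_univ, true_and, Prod.exists, Finset.mem_product,
        and_true] at hB ⊢
      obtain ⟨σ, τ, rfl⟩ := hB
      obtain ⟨σ', hσ', c, hc⟩ := hσ σ
      refine ⟨σ', τ.trans (Equiv.addLeft c), hσ', ?_⟩
      ext i j
      simp [hc i, hA, cornerSquare_cyclic]
    · exact Finset.image_subset_image (Finset.subset_univ _)
  have hinj : ∀ (i : Fin 3) (τ τ' : Equiv.Perm (Fin 3)), (∀ j, A i (τ j) = A i (τ' j)) →
      τ = τ' := by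
    intro i τ τ' e
    ext1 j
    by_contra hj
    exact hrow _ _ _ hj (e j)
  rw [himage, Finset.card_image_of_injOn]
  · rw [Finset.card_product, Finset.card_pair hone, Finset.card_univ, Fintype.card_perm]
    rfl
  · rintro ⟨σ, τ⟩ h1 ⟨σ', τ'⟩ h2 e
    have e' : ∀ i j, A (σ i) (τ j) = A (σ' i) (τ' j) := fun i j => congrFun (congrFun e i) j
    simp only [Finset.coe_product, Set.mem_prod, Finset.mem_coe, Finset.mem_insert,
      Finset.mem_singleton, Finset.mem_univ, and_true] at h1 h2
    -- Both coset representatives fix row 0, so that row alone recovers the column permutation.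
    have hfix : σ 0 = 0 ∧ σ' 0 = 0 := by
      rcases h1 with rfl | rfl <;> rcases h2 with rfl | rfl <;> decide
    obtain rfl : τ = τ' := hinj 0 τ τ' (fun j => by simpa [hfix.1, hfix.2] using e' 0 j)
    have : σ = σ' := by
      ext1 i
      by_contra hi
      exact hcol _ _ _ hi (e' i 0)
    rw [this]

/-- The number of squares equivalent to `cornerSquare m p q r s`. -/
def classSize (p q r s : ℕ) : ℕ :=
  if r = 0 then 12 else if s = 0 ∨ q = 0 ∨ p = q ∨ r = s then 36 else 72

lemma IsNormal.card_symmetryClass {m p q r s : ℕ} (h : IsNormal p q r s) :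
    (symmetryClass (cornerSquare m p q r s)).card = classSize p q r s := by
  unfold classSize
  split_ifs with h1 h2
  · obtain rfl : r = 0 := h1
    obtain rfl : s = 0 := Nat.le_zero.1 h.2.1
    exact card_symmetryClass_eq_12 h
  · exact card_symmetryClass_eq_36 (h.stabilizer h1) (exists_submatrix_eq_transpose h2)
  · push Not at h2
    exact card_symmetryClass_eq_72 (h.stabilizer h1)
      (h.submatrix_ne_transpose h2.1 h2.2.1 h2.2.2.1 h2.2.2.2)

/-! ### Decomposition by least entry and range -/

/-- The smallest entry of `A` is `m` and the largest is `m + w`. -/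
def HasRange (A : Matrix (Fin 3) (Fin 3) ℕ) (m w : ℕ) : Prop :=
  (∃ i j, A i j = m) ∧ (∃ i j, A i j = m + w) ∧ ∀ i j, m ≤ A i j ∧ A i j ≤ m + w

lemma HasRange.of_equiv {A B : Matrix (Fin 3) (Fin 3) ℕ} {m w : ℕ} (h : HasRange A m w)
    (e : squareSetoid.r A B) : HasRange B m w :=
  ⟨exists_entry_of_equiv e (P := fun x => x = m) h.1,
    exists_entry_of_equiv e (P := fun x => x = m + w) h.2.1,
    forall_entries_of_equiv e (P := fun x => m ≤ x ∧ x ≤ m + w) h.2.2⟩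

lemma HasRange.unique {A : Matrix (Fin 3) (Fin 3) ℕ} {m w m' w' : ℕ} (h : HasRange A m w)
    (h' : HasRange A m' w') : m = m' ∧ w = w' := by
  obtain ⟨⟨i, j, h1⟩, ⟨k, l, h2⟩, h3⟩ := h
  obtain ⟨⟨i', j', h1'⟩, ⟨k', l', h2'⟩, h3'⟩ := h'
  have := h3 i' j'
  have := h3 k' l'
  have := h3' i j
  have := h3' k l
  omega

lemma exists_hasRange (A : Matrix (Fin 3) (Fin 3) ℕ) : ∃ m w, HasRange A m w := by
  obtain ⟨⟨i, j⟩, h⟩ := Finite.exists_min (fun x : Fin 3 × Fin 3 => A x.1 x.2)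
  obtain ⟨⟨k, l⟩, h'⟩ := Finite.exists_max (fun x : Fin 3 × Fin 3 => A x.1 x.2)
  have hle : A i j ≤ A k l := h (k, l)
  exact ⟨A i j, A k l - A i j, ⟨i, j, rfl⟩, ⟨k, l, by omega⟩,
    fun a b => ⟨h (a, b), (h' (a, b)).trans (by simp; omega)⟩⟩

lemma IsNormal.hasRange {p q r s : ℕ} (h : IsNormal p q r s) (m : ℕ) :
    HasRange (cornerSquare m p q r s) m (p + r) := by
  unfold IsNormal at h
  refine ⟨⟨0, 0, by simp [cornerSquare]⟩, ⟨0, 1, by simp [cornerSquare, add_assoc]⟩, ?_⟩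
  intro i j
  fin_cases i <;> fin_cases j <;> simp [cornerSquare] <;> omega

open Classical in
/-- The triples `(r, s, q)` for which `p = w - r` gives a normal form with range `w`. -/
noncomputable def normalTriples (w : ℕ) : Finset (ℕ × ℕ × ℕ) :=
  (Finset.range (w + 1) ×ˢ Finset.range (w + 1) ×ˢ Finset.range (w + 1)).filter
    (fun x => IsNormal (w - x.1) x.2.2 x.1 x.2.1)

lemma mem_normalTriples {w : ℕ} {x : ℕ × ℕ × ℕ} :
    x ∈ normalTriples w ↔ IsNormal (w - x.1) x.2.2 x.1 x.2.1 := by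
  simp only [normalTriples, Finset.mem_filter, Finset.mem_product, Finset.mem_range,
    and_iff_right_iff_imp]
  rintro ⟨h1, h2, h3, -⟩
  omega

/-- The number of squares with least entry `m` and range `w`, for any `m`. -/
noncomputable def rangeCount (w : ℕ) : ℕ :=
  ∑ x ∈ normalTriples w, classSize (w - x.1) x.2.2 x.1 x.2.1

/-- The squares whose least entry and range form a pair in `M`. -/
def squaresWithRange (M : Finset (ℕ × ℕ)) : Set (Matrix (Fin 3) (Fin 3) ℕ) :=
  {A | IsMagilatin A ∧ ∃ y ∈ M, HasRange A y.1 y.2}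

/-- The normal form with least entry and range `x.1` and parameters `x.2`. -/
def normalSquare (x : (_ : ℕ × ℕ) × (ℕ × ℕ × ℕ)) : Matrix (Fin 3) (Fin 3) ℕ :=
  cornerSquare x.1.1 (x.1.2 - x.2.1) x.2.2.2 x.2.1 x.2.2.1

lemma mem_squaresWithRange_iff {M : Finset (ℕ × ℕ)} {A : Matrix (Fin 3) (Fin 3) ℕ} :
    A ∈ squaresWithRange M ↔
      ∃ x ∈ M.sigma (fun y => normalTriples y.2), squareSetoid.r (normalSquare x) A := by
  constructor
  · rintro ⟨hA, ⟨m, w⟩, hM, hr⟩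
    obtain ⟨m', p, q, r, s, hn, e⟩ := exists_equiv_normal hA
    obtain ⟨rfl, rfl⟩ := (hr.of_equiv e).unique (hn.hasRange m')
    refine ⟨⟨(m, p + r), (r, s, q)⟩, ?_, ?_⟩
    · simp only [Finset.mem_sigma, mem_normalTriples, Nat.add_sub_cancel]
      exact ⟨hM, hn⟩
    · simp only [normalSquare, Nat.add_sub_cancel]
      exact squareSetoid.symm e
  · rintro ⟨⟨⟨m, w⟩, ⟨r, s, q⟩⟩, hx, e⟩
    rw [Finset.mem_sigma, mem_normalTriples] at hx
    obtain ⟨hM, hn⟩ := hx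
    simp only at hn hM
    refine ⟨((isMagilatin_cornerSquare_iff ..).2 hn.2.2.2).of_equiv e, (m, w), hM, ?_⟩
    have := (hn.hasRange m).of_equiv e
    rwa [Nat.sub_add_cancel (by have := hn.2.2.1; omega)] at this

lemma normalSquare_unique {M : Finset (ℕ × ℕ)} {x y : (_ : ℕ × ℕ) × (ℕ × ℕ × ℕ)}
    (hx : x ∈ M.sigma (fun y => normalTriples y.2))
    (hy : y ∈ M.sigma (fun y => normalTriples y.2))
    (e : squareSetoid.r (normalSquare x) (normalSquare y)) : x = y := by
  obtain ⟨⟨m, w⟩, ⟨r, s, q⟩⟩ := x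
  obtain ⟨⟨m', w'⟩, ⟨r', s', q'⟩⟩ := y
  rw [Finset.mem_sigma, mem_normalTriples] at hx hy
  have hn : IsNormal (w - r) q r s := hx.2
  have hn' : IsNormal (w' - r') q' r' s' := hy.2
  obtain ⟨rfl, h1, rfl, rfl, rfl⟩ := hn.unique hn' e
  obtain rfl : w = w' := by
    have := hn.2.2.1
    have := hn'.2.2.1
    omega
  rfl

lemma numSymmetryTypes_squaresWithRange (M : Finset (ℕ × ℕ)) :
    numSymmetryTypes (squaresWithRange M) = ∑ y ∈ M, (normalTriples y.2).card := by
  have himage : Quotient.mk squareSetoid '' squaresWithRange M =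
      (fun x => Quotient.mk squareSetoid (normalSquare x)) ''
        (M.sigma (fun y => normalTriples y.2) : Set ((_ : ℕ × ℕ) × (ℕ × ℕ × ℕ))) := by
    ext c
    constructor
    · rintro ⟨A, hA, rfl⟩
      obtain ⟨x, hx, e⟩ := mem_squaresWithRange_iff.1 hA
      exact ⟨x, hx, Quotient.sound e⟩
    · rintro ⟨x, hx, rfl⟩
      exact ⟨normalSquare x, mem_squaresWithRange_iff.2 ⟨x, hx, squareSetoid.refl _⟩, rfl⟩
  rw [numSymmetryTypes, himage, Set.InjOn.ncard_image, Set.ncard_coe_finset,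
    Finset.card_sigma]
  intro x hx y hy e
  exact normalSquare_unique hx hy (Quotient.exact e)

/-- The set is the disjoint union of the symmetry classes of its normal forms, and class sizes do
not depend on the least entry. -/
lemma ncard_squaresWithRange (M : Finset (ℕ × ℕ)) :
    (squaresWithRange M).ncard = ∑ y ∈ M, rangeCount y.2 := by
  classical
  have hunion : squaresWithRange M = ((M.sigma (fun y => normalTriples y.2)).biUnion
      (fun x => symmetryClass (normalSquare x)) : Finset (Matrix (Fin 3) (Fin 3) ℕ)) := by
    ext A
    rw [mem_squaresWithRange_iff, Finset.mem_coe, Finset.mem_biUnion]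
    simp only [mem_symmetryClass]
  rw [hunion, Set.ncard_coe_finset, Finset.card_biUnion, Finset.sum_sigma]
  · refine Finset.sum_congr rfl fun y _ => Finset.sum_congr rfl fun x hx => ?_
    exact (mem_normalTriples.1 hx).card_symmetryClass
  · intro x hx y hy hxy
    rw [Function.onFun, Finset.disjoint_left]
    intro A hA hA'
    rw [mem_symmetryClass] at hA hA'
    exact hxy (normalSquare_unique hx hy (squareSetoid.trans hA (squareSetoid.symm hA')))

lemma reducedMagilatinSquares_eq (w : ℕ) :
    reducedMagilatinSquares w = squaresWithRange {(0, w)} := by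
  ext A
  simp [reducedMagilatinSquares, squaresWithRange, HasRange]

lemma magilatinSquares_eq (t : ℕ) :
    magilatinSquares t = squaresWithRange
      ((Finset.range t).sigma (fun w => Finset.Ico 1 (t - w)) |>.image fun x => (x.2, x.1)) := by
  ext A
  simp only [magilatinSquares, squaresWithRange, Set.mem_ofPred_eq, Finset.mem_image,
    Finset.mem_sigma, Finset.mem_range, Finset.mem_Ico, Sigma.exists]
  refine and_congr_right fun _ => ⟨fun h => ?_, ?_⟩
  · obtain ⟨m, w, hr⟩ := exists_hasRange A
    refine ⟨(m, w), ⟨w, m, ?_, rfl⟩, hr⟩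
    obtain ⟨⟨i, j, h1⟩, ⟨k, l, h2⟩, -⟩ := hr
    have := h i j
    have := h k l
    omega
  · rintro ⟨_, ⟨w, m, hm, rfl⟩, -, -, hr⟩ i j
    have := hr i j
    omega

lemma sum_ranges (t : ℕ) (f : ℕ → ℕ) :
    ∑ y ∈ ((Finset.range t).sigma (fun w => Finset.Ico 1 (t - w)) |>.image
      fun x => (x.2, x.1)), f y.2 = ∑ w ∈ Finset.range t, (t - 1 - w) * f w := by
  rw [Finset.sum_image, Finset.sum_sigma]
  · refine Finset.sum_congr rfl fun w _ => ?_
    simp [Nat.sub_right_comm]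
  · rintro ⟨a, b⟩ _ ⟨c, d⟩ _ e
    simp only [Prod.mk.injEq] at e
    obtain ⟨rfl, rfl⟩ := e
    rfl

lemma reducedMagilatinCount_eq (w : ℕ) : reducedMagilatinCount w = rangeCount w := by
  rw [reducedMagilatinCount, reducedMagilatinSquares_eq, ncard_squaresWithRange,
    Finset.sum_singleton]

lemma reducedMagilatinTypeCount_eq (w : ℕ) :
    reducedMagilatinTypeCount w = (normalTriples w).card := by
  rw [reducedMagilatinTypeCount, reducedMagilatinSquares_eq,
    numSymmetryTypes_squaresWithRange, Finset.sum_singleton]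

lemma magilatinCount_eq (t : ℕ) :
    magilatinCount t = ∑ w ∈ Finset.range t, (t - 1 - w) * reducedMagilatinCount w := by
  simp only [reducedMagilatinCount_eq]
  rw [magilatinCount, magilatinSquares_eq, ncard_squaresWithRange, sum_ranges]

lemma magilatinTypeCount_eq (t : ℕ) :
    magilatinTypeCount t = ∑ w ∈ Finset.range t, (t - 1 - w) * reducedMagilatinTypeCount w := by
  simp only [reducedMagilatinTypeCount_eq]
  rw [magilatinTypeCount, magilatinSquares_eq, numSymmetryTypes_squaresWithRange,
    sum_ranges t (fun w => (normalTriples w).card)]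

/-- The weights are linear in t for w < t, so their second difference vanishes there; only w = t,
with weight 1 in the first sum, survives. -/
lemma sum_range_weighted_second_difference (f : ℕ → ℕ) (t : ℕ) :
    (∑ w ∈ Finset.range (t + 2), (t + 2 - 1 - w) * f w) +
      (∑ w ∈ Finset.range t, (t - 1 - w) * f w) =
    2 * (∑ w ∈ Finset.range (t + 1), (t + 1 - 1 - w) * f w) + f t := by
  have h1 : ∑ w ∈ Finset.range t, (t + 2 - 1 - w) * f w =
      ∑ w ∈ Finset.range t, (t - 1 - w) * f w + 2 * ∑ w ∈ Finset.range t, f w := by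
    rw [Finset.mul_sum, ← Finset.sum_add_distrib]
    refine Finset.sum_congr rfl fun w hw => ?_
    rw [← add_mul]
    congr 1
    have := Finset.mem_range.1 hw
    omega
  have h2 : ∑ w ∈ Finset.range t, (t + 1 - 1 - w) * f w =
      ∑ w ∈ Finset.range t, (t - 1 - w) * f w + ∑ w ∈ Finset.range t, f w := by
    rw [← Finset.sum_add_distrib]
    refine Finset.sum_congr rfl fun w hw => ?_
    rw [← add_one_mul]
    congr 1
    have := Finset.mem_range.1 hw
    omega
  rw [Finset.sum_range_succ, Finset.sum_range_succ, Finset.sum_range_succ, h1, h2]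
  have e1 : t + 2 - 1 - t = 1 := by omega
  simp only [e1, Nat.add_sub_cancel, Nat.sub_self]
  have e2 : t + 2 - 1 - (t + 1) = 0 := by omega
  rw [e2]
  ring

/-! ### Counting the admissible values of q -/

/-- Six of the eighteen distinctness conditions forbid these values; the orderings together with
these six imply the rest. The forbidden set is invariant under x ↦ p - x. -/
lemma isNormal_iff {p q r s : ℕ} (hsr : s ≤ r) (hrp : r < p) :
    IsNormal p q r s ↔
      q ≤ p ∧ q ∉ ({s, r - s, r, p - s, p - (r - s), p - r} : Finset ℕ) := by
  unfold IsNormal CornerDistinct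
  simp only [Finset.mem_insert, Finset.mem_singleton]
  omega

/-- The values of `q` for which `p, q, r, s` is a normal form. -/
def admissible (p r s : ℕ) : Finset ℕ :=
  Finset.range (p + 1) \ {s, r - s, r, p - s, p - (r - s), p - r}

lemma mem_admissible {p q r s : ℕ} (hsr : s ≤ r) (hrp : r < p) :
    q ∈ admissible p r s ↔ IsNormal p q r s := by
  rw [isNormal_iff hsr hrp, admissible, Finset.mem_sdiff, Finset.mem_range, Nat.lt_succ_iff]

lemma sum_normalTriples (w : ℕ) (f : ℕ × ℕ × ℕ → ℕ) :
    ∑ x ∈ normalTriples w, f x =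
      ∑ r ∈ Finset.range ((w + 1) / 2), ∑ s ∈ Finset.range (r + 1),
        ∑ q ∈ admissible (w - r) r s, f (r, s, q) := by
  rw [Finset.sum_finset_product (normalTriples w) (Finset.range ((w + 1) / 2))
    (fun r => (Finset.range (r + 1) ×ˢ Finset.range (w + 1)).filter
      (fun x => x.2 ∈ admissible (w - r) r x.1))]
  · refine Finset.sum_congr rfl fun r hr => ?_
    refine Finset.sum_finset_product _ _ _ ?_
    rintro ⟨s, q⟩
    simp only [Finset.mem_filter, Finset.mem_product, Finset.mem_range, and_assoc,
      and_congr_right_iff, and_iff_right_iff_imp]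
    intro _ h
    rw [admissible, Finset.mem_sdiff, Finset.mem_range] at h
    omega
  · rintro ⟨r, s, q⟩
    simp only [mem_normalTriples, Finset.mem_filter, Finset.mem_product, Finset.mem_range]
    constructor
    · intro h
      have h1 := h.1
      have h2 := h.2.1
      have h3 := h.2.2.1
      exact ⟨by omega, ⟨by omega, by omega⟩, (mem_admissible h2 h3).2 h⟩
    · rintro ⟨h1, ⟨h2, -⟩, h3⟩
      exact (mem_admissible (by omega) (by omega)).1 h3

lemma card_admissible_add_card {p r s : ℕ} (hsr : s ≤ r) (hrp : r < p) :
    (admissible p r s).card + ({s, r - s, r, p - s, p - (r - s), p - r} : Finset ℕ).card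
      = p + 1 := by
  rw [admissible, Finset.card_sdiff_add_card_eq_card, Finset.card_range]
  intro x hx
  simp only [Finset.mem_insert, Finset.mem_singleton] at hx
  rw [Finset.mem_range]
  omega

lemma card_admissible_zero {p : ℕ} (hp : 0 < p) : (admissible p 0 0).card + 2 = p + 1 := by
  have h := card_admissible_add_card (p := p) (r := 0) (s := 0) le_rfl hp
  have : ({0, 0 - 0, 0, p - 0, p - (0 - 0), p - 0} : Finset ℕ).card = 2 := by
    have : ({0, 0 - 0, 0, p - 0, p - (0 - 0), p - 0} : Finset ℕ) = {0, p} := by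
      ext x; simp
    rw [this, Finset.card_pair (by omega)]
  omega

lemma card_admissible_edge {p r s : ℕ} (hr : 0 < r) (hs : s = 0 ∨ s = r) (hrp : r < p) :
    (admissible p r s).card + 4 = p + 1 + (if p = 2 * r then 1 else 0) := by
  have h := card_admissible_add_card (p := p) (r := r) (s := s) (by omega) hrp
  have : ({s, r - s, r, p - s, p - (r - s), p - r} : Finset ℕ) = {0, p, r, p - r} := by
    ext x
    simp only [Finset.mem_insert, Finset.mem_singleton]
    omega
  rw [this] at h
  simp only [Finset.card_insert_eq_ite, Finset.mem_insert, Finset.mem_singleton,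
    Finset.card_singleton] at h
  split_ifs at h ⊢ <;> omega

lemma card_insert_add_ite (a : ℕ) (S : Finset ℕ) :
    (insert a S).card + (if a ∈ S then 1 else 0) = S.card + 1 := by
  rw [Finset.card_insert_eq_ite]
  split_ifs <;> rfl

/-- With b = r - s, c = p - r and p = s + b + c, the forbidden values are the three gaps and their
pairwise sums. Two equal gaps also make two pair sums equal and so cost two elements; a gap equal to
the sum of the other two costs one. When all gaps agree, two elements remain, so the three double
losses overcount by two. -/
lemma card_difference_set {s b c : ℕ} (hs : 0 < s) (hb : 0 < b) (hc : 0 < c) :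
    ({s, b, s + b, b + c, s + c, c} : Finset ℕ).card + 2 * (if s = b then 1 else 0) +
      (if s + b + c = 2 * (s + b) then 1 else 0) +
      (if s + b + c = 2 * s then 1 else 0) + (if s + b + c = 2 * b then 1 else 0) +
      2 * (if c = s then 1 else 0) + 2 * (if c = b then 1 else 0)
     = 6 + 2 * (if s = b ∧ c = s then 1 else 0) := by
  have h1 := card_insert_add_ite s {b, s + b, b + c, s + c, c}
  have h2 := card_insert_add_ite b {s + b, b + c, s + c, c}
  have h3 := card_insert_add_ite (s + b) {b + c, s + c, c}
  have h4 := card_insert_add_ite (b + c) {s + c, c}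
  have h5 := card_insert_add_ite (s + c) {c}
  simp only [Finset.mem_insert, Finset.mem_singleton, Finset.card_singleton] at h1 h2 h3 h4 h5
  grind (splits := 25)

lemma card_admissible_interior {p r s : ℕ} (hs : 0 < s) (hsr : s < r) (hrp : r < p) :
    (admissible p r s).card + 6 + 2 * (if 2 * s = r ∧ p = 3 * s then 1 else 0) =
      p + 1 + (if p = 2 * r then 1 else 0) + 2 * (if 2 * s = r then 1 else 0) +
      (if p = 2 * s then 1 else 0) + (if p = 2 * (r - s) then 1 else 0) +
      2 * (if p = s + r then 1 else 0) + 2 * (if p = (r - s) + r then 1 else 0) := by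
  have h := card_admissible_add_card hsr.le hrp
  obtain ⟨b, rfl⟩ := Nat.exists_eq_add_of_le hsr.le
  obtain ⟨c, rfl⟩ := Nat.exists_eq_add_of_le hrp.le
  have e1 : s + b - s = b := by omega
  have e2 : s + b + c - s = b + c := by omega
  have e3 : s + b + c - b = s + c := by omega
  have e4 : s + b + c - (s + b) = c := by omega
  rw [e1, e2, e3, e4] at h
  rw [e1]
  have h' := card_difference_set hs (by omega : 0 < b) (by omega : 0 < c)
  simp only [show 2 * s = s + b ↔ s = b by omega,
    show (s = b ∧ s + b + c = 3 * s) ↔ (s = b ∧ c = s) by omega,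
    show s + b + c = s + (s + b) ↔ c = s by omega,
    show s + b + c = b + (s + b) ↔ c = b by omega]
  omega

lemma sum_classSize_zero (p : ℕ) :
    ∑ q ∈ admissible p 0 0, classSize p q 0 0 = 12 * (admissible p 0 0).card := by
  simp [classSize, mul_comm]

lemma sum_classSize_edge {p r s : ℕ} (hr : 0 < r) (hs : s = 0 ∨ s = r) :
    ∑ q ∈ admissible p r s, classSize p q r s = 36 * (admissible p r s).card := by
  rw [mul_comm, ← smul_eq_mul, ← Finset.sum_const]
  refine Finset.sum_congr rfl fun q _ => ?_
  rw [classSize, if_neg hr.ne', if_pos (by omega)]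

/-- Here only q = 0 and q = p have class size 36 instead of 72. Both are admissible, since every
forbidden value lies strictly between 0 and p. -/
lemma sum_classSize_interior {p r s : ℕ} (hs : 0 < s) (hsr : s < r) (hrp : r < p) :
    ∑ q ∈ admissible p r s, classSize p q r s + 72 = 72 * (admissible p r s).card := by
  have hmem : ∀ q, (q = 0 ∨ q = p) → q ∈ admissible p r s := by
    intro q hq
    simp only [admissible, Finset.mem_sdiff, Finset.mem_range, Finset.mem_insert,
      Finset.mem_singleton]
    omega
  have h : ∑ q ∈ admissible p r s, (classSize p q r s +
      ((if q = 0 then 36 else 0) + (if q = p then 36 else 0))) =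
      ∑ q ∈ admissible p r s, 72 := by
    refine Finset.sum_congr rfl fun q _ => ?_
    rw [classSize, if_neg (by omega)]
    split_ifs <;> omega
  rw [Finset.sum_add_distrib, Finset.sum_add_distrib, Finset.sum_ite_eq', Finset.sum_ite_eq',
    if_pos (hmem 0 (Or.inl rfl)), if_pos (hmem p (Or.inr rfl)), Finset.sum_const,
    smul_eq_mul] at h
  omega

/-- Used for linear equations in the summation variable: `s₀` is the only candidate solution and `Q`
says when it is a solution within the range. -/
lemma sum_indicator_unique {I : Finset ℕ} {P : ℕ → Prop} [DecidablePred P] {Q : Prop}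
    [Decidable Q] (s₀ : ℕ) (h1 : ∀ s ∈ I, P s ↔ Q ∧ s = s₀) (h2 : Q → s₀ ∈ I) :
    (∑ s ∈ I, if P s then (1 : ℤ) else 0) = if Q then 1 else 0 := by
  by_cases hQ : Q
  · rw [if_pos hQ, Finset.sum_eq_single s₀]
    · rw [if_pos ((h1 _ (h2 hQ)).2 ⟨hQ, rfl⟩)]
    · intro s hs hne
      rw [if_neg fun h => hne ((h1 s hs).1 h).2]
    · exact fun h => absurd (h2 hQ) h
  · rw [if_neg hQ]
    refine Finset.sum_eq_zero fun s hs => ?_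
    rw [if_neg fun h => hQ ((h1 s hs).1 h).1]

/-- The number of normal forms with given `p`, `r` and `0 < s < r`. -/
def interiorCount (p r : ℕ) : ℤ :=
  ((r : ℤ) - 1) * ((p : ℤ) - 5 + if p = 2 * r then 1 else 0) +
    2 * (if r % 2 = 0 then 1 else 0) + 2 * (if p % 2 = 0 ∧ p + 2 ≤ 2 * r then 1 else 0) +
    4 * (if p + 1 ≤ 2 * r then 1 else 0) - 2 * (if 2 * p = 3 * r then 1 else 0)

/-- The number of normal forms with given `p`, `r` and `s = 0`. -/
def edgeCount (p r : ℕ) : ℤ := (p : ℤ) - 3 + if p = 2 * r then 1 else 0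

lemma sum_card_admissible_interior {p r : ℕ} (hr : 0 < r) (hrp : r < p) :
    ∑ s ∈ Finset.Ico 1 r, ((admissible p r s).card : ℤ) = interiorCount p r := by
  have h : ∀ s ∈ Finset.Ico 1 r, ((admissible p r s).card : ℤ) =
      ((p : ℤ) - 5 + if p = 2 * r then 1 else 0) + 2 * (if 2 * s = r then 1 else 0) +
      (if p = 2 * s then 1 else 0) + (if p = 2 * (r - s) then 1 else 0) +
      2 * (if p = s + r then 1 else 0) + 2 * (if p = (r - s) + r then 1 else 0) -
      2 * (if 2 * s = r ∧ p = 3 * s then 1 else 0) := by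
    intro s hs
    rw [Finset.mem_Ico] at hs
    have := card_admissible_interior (p := p) hs.1 hs.2 hrp
    have := congrArg (Nat.cast : ℕ → ℤ) this
    push_cast at this
    linarith
  rw [Finset.sum_congr rfl h]
  simp only [Finset.sum_add_distrib, Finset.sum_sub_distrib, ← Finset.mul_sum]
  rw [sum_indicator_unique (P := fun s => 2 * s = r) (Q := r % 2 = 0) (r / 2)
      (by simp only [Finset.mem_Ico]; omega) (by simp only [Finset.mem_Ico]; omega),
    sum_indicator_unique (P := fun s => p = 2 * s) (Q := p % 2 = 0 ∧ p + 2 ≤ 2 * r) (p / 2)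
      (by simp only [Finset.mem_Ico]; omega) (by simp only [Finset.mem_Ico]; omega),
    sum_indicator_unique (P := fun s => p = 2 * (r - s)) (Q := p % 2 = 0 ∧ p + 2 ≤ 2 * r)
      (r - p / 2)
      (by simp only [Finset.mem_Ico]; omega) (by simp only [Finset.mem_Ico]; omega),
    sum_indicator_unique (P := fun s => p = s + r) (Q := p + 1 ≤ 2 * r) (p - r)
      (by simp only [Finset.mem_Ico]; omega) (by simp only [Finset.mem_Ico]; omega),
    sum_indicator_unique (P := fun s => p = (r - s) + r) (Q := p + 1 ≤ 2 * r) (2 * r - p)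
      (by simp only [Finset.mem_Ico]; omega) (by simp only [Finset.mem_Ico]; omega),
    sum_indicator_unique (P := fun s => 2 * s = r ∧ p = 3 * s) (Q := 2 * p = 3 * r) (r / 2)
      (by simp only [Finset.mem_Ico]; omega) (by simp only [Finset.mem_Ico]; omega)]
  simp only [Finset.sum_const, Nat.card_Ico, nsmul_eq_mul, interiorCount]
  rw [Nat.cast_sub hr]
  push_cast
  ring

lemma sum_range_succ_eq_ends_add_Ico {r : ℕ} (hr : 0 < r) (f : ℕ → ℤ) :
    ∑ s ∈ Finset.range (r + 1), f s = f 0 + f r + ∑ s ∈ Finset.Ico 1 r, f s := by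
  rw [Finset.sum_range_succ, Finset.range_eq_Ico, Finset.sum_eq_sum_Ico_succ_bot hr]
  ring

lemma sum_range_eq_zero_add_Ico {n : ℕ} (hn : 0 < n) (f : ℕ → ℤ) :
    ∑ s ∈ Finset.range n, f s = f 0 + ∑ s ∈ Finset.Ico 1 n, f s := by
  rw [Finset.range_eq_Ico, Finset.sum_eq_sum_Ico_succ_bot hn]

lemma card_normalTriples {w : ℕ} (hw : 0 < w) :
    ((normalTriples w).card : ℤ) = (w - 1) + ∑ r ∈ Finset.Ico 1 ((w + 1) / 2),
      (2 * edgeCount (w - r) r + interiorCount (w - r) r) := by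
  have h := sum_normalTriples w (fun _ => 1)
  simp only [Finset.sum_const, smul_eq_mul, mul_one] at h
  rw [h]
  push_cast
  rw [sum_range_eq_zero_add_Ico (by omega)]
  congr 1
  · have := card_admissible_zero hw
    simp only [Nat.sub_zero, zero_add, Finset.sum_range_one]
    omega
  · refine Finset.sum_congr rfl fun r hr => ?_
    rw [Finset.mem_Ico] at hr
    rw [sum_range_succ_eq_ends_add_Ico hr.1, sum_card_admissible_interior hr.1 (by omega)]
    have e0 := card_admissible_edge (p := w - r) hr.1 (Or.inl rfl) (by omega)
    have e1 := card_admissible_edge (p := w - r) hr.1 (Or.inr rfl) (by omega)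
    have e0 := congrArg (Nat.cast : ℕ → ℤ) e0
    have e1 := congrArg (Nat.cast : ℕ → ℤ) e1
    push_cast at e0 e1
    rw [edgeCount]
    linarith

lemma rangeCount_eq_sum {w : ℕ} (hw : 0 < w) :
    (rangeCount w : ℤ) = 12 * (w - 1) + ∑ r ∈ Finset.Ico 1 ((w + 1) / 2),
      (72 * edgeCount (w - r) r + 72 * (interiorCount (w - r) r - (r - 1))) := by
  rw [rangeCount, sum_normalTriples]
  push_cast
  rw [sum_range_eq_zero_add_Ico (by omega)]
  congr 1
  · have := card_admissible_zero hw
    have h2 := sum_classSize_zero w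
    simp only [Nat.sub_zero, zero_add, Finset.sum_range_one]
    zify at h2 this
    linarith
  · refine Finset.sum_congr rfl fun r hr => ?_
    rw [Finset.mem_Ico] at hr
    rw [sum_range_succ_eq_ends_add_Ico hr.1, ← sum_card_admissible_interior hr.1 (by omega)]
    have e0 := card_admissible_edge (p := w - r) hr.1 (Or.inl rfl) (by omega)
    have e1 := card_admissible_edge (p := w - r) hr.1 (Or.inr rfl) (by omega)
    have f0 := sum_classSize_edge (p := w - r) hr.1 (Or.inl rfl)
    have f1 := sum_classSize_edge (p := w - r) hr.1 (Or.inr rfl)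
    have hi : ∑ s ∈ Finset.Ico 1 r, (∑ q ∈ admissible (w - r) r s,
        (classSize (w - r) q r s : ℤ)) =
        72 * (∑ s ∈ Finset.Ico 1 r, ((admissible (w - r) r s).card : ℤ) - (r - 1)) := by
      have : ((r : ℤ) - 1) = ∑ s ∈ Finset.Ico 1 r, 1 := by
        rw [Finset.sum_const, Nat.card_Ico, nsmul_eq_mul, Nat.cast_sub hr.1]
        simp
      rw [this, ← Finset.sum_sub_distrib, Finset.mul_sum]
      refine Finset.sum_congr rfl fun s hs => ?_
      rw [Finset.mem_Ico] at hs
      have := sum_classSize_interior (p := w - r) hs.1 hs.2 (by omega)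
      zify at this
      linarith
    rw [hi]
    have e0 := congrArg (Nat.cast : ℕ → ℤ) e0
    have e1 := congrArg (Nat.cast : ℕ → ℤ) e1
    push_cast at e0 e1
    zify at f0 f1
    rw [edgeCount]
    linarith

/-! ### Closed forms for the sums over r -/

lemma sum_interior_polynomial (w : ℤ) (n : ℕ) :
    6 * ∑ r ∈ Finset.Ico 1 (n + 1), ((r : ℤ) - 1) * (w - r - 5) =
      -n * (n + 1) * (2 * n + 1) + 3 * (w - 4) * n * (n + 1) - 6 * (w - 5) * n := by
  induction n with
  | zero => simp
  | succ n ih =>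
    rw [Finset.sum_Ico_succ_top (by omega), mul_add, ih]
    push_cast
    ring

lemma sum_edge_polynomial (w : ℤ) (n : ℕ) :
    2 * ∑ r ∈ Finset.Ico 1 (n + 1), (w - (r : ℤ) - 3) = 2 * n * (w - 3) - n * (n + 1) := by
  induction n with
  | zero => simp
  | succ n ih =>
    rw [Finset.sum_Ico_succ_top (by omega), mul_add, ih]
    push_cast
    ring

lemma sum_indicator_even (n : ℕ) :
    ∑ r ∈ Finset.Ico 1 (n + 1), (if r % 2 = 0 then (1 : ℤ) else 0) = (n / 2 : ℕ) := by
  induction n with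
  | zero => simp
  | succ n ih =>
    rw [Finset.sum_Ico_succ_top (by omega), ih]
    split_ifs <;> omega

/-- There are (n + w % 2) / 2 numbers in 1, ..., n with the parity of w. Those up to (w + 1) / 3 are
removed, and truncated subtraction gives 0 while n is below that bound. -/
lemma sum_indicator_same_parity (w n : ℕ) :
    ∑ r ∈ Finset.Ico 1 (n + 1), (if r % 2 = w % 2 ∧ w + 2 ≤ 3 * r then (1 : ℤ) else 0) =
      ((n + w % 2) / 2 - ((w + 1) / 3 + w % 2) / 2 : ℕ) := by
  induction n with
  | zero => simp
  | succ n ih =>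
    rw [Finset.sum_Ico_succ_top (by omega), ih]
    split_ifs <;> omega

lemma sum_indicator_lower (w n : ℕ) :
    ∑ r ∈ Finset.Ico 1 (n + 1), (if w + 1 ≤ 3 * r then (1 : ℤ) else 0) =
      (n - w / 3 : ℕ) := by
  induction n with
  | zero => simp
  | succ n ih =>
    rw [Finset.sum_Ico_succ_top (by omega), ih]
    split_ifs <;> omega

lemma two_mul_sum_edgeCount {w n : ℕ} (hw : 0 < w) (hn : n = (w - 1) / 2) :
    2 * ∑ r ∈ Finset.Ico 1 (n + 1), edgeCount (w - r) r =
      2 * n * (w - 3) - n * (n + 1) + 2 * (if w % 3 = 0 then 1 else 0) := by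
  have h : ∀ r ∈ Finset.Ico 1 (n + 1), edgeCount (w - r) r =
      ((w : ℤ) - r - 3) + if w = 3 * r then 1 else 0 := by
    intro r hr
    rw [Finset.mem_Ico] at hr
    rw [edgeCount, Nat.cast_sub (by omega)]
    simp only [show w - r = 2 * r ↔ w = 3 * r by omega]
  rw [Finset.sum_congr rfl h, Finset.sum_add_distrib, mul_add, sum_edge_polynomial,
    sum_indicator_unique (P := fun r => w = 3 * r) (Q := w % 3 = 0) (w / 3)
      (by simp only [Finset.mem_Ico]; omega) (by simp only [Finset.mem_Ico]; omega)]

/-- Putting p = w - r turns the coincidences into w = 3r, 2w = 5r, parity conditions and bounds on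
3r. With the upper limit n = (w - 1) / 2, and hence n / 2, these account for the moduli 3, 5 and 4,
and so for the period 60. -/
lemma six_mul_sum_interiorCount {w n : ℕ} (hw : 0 < w) (hn : n = (w - 1) / 2) :
    6 * ∑ r ∈ Finset.Ico 1 (n + 1), interiorCount (w - r) r =
      (-n * (n + 1) * (2 * n + 1) + 3 * (w - 4) * n * (n + 1) - 6 * (w - 5) * n) +
      2 * (w - 3) * (if w % 3 = 0 then 1 else 0) + 12 * (n / 2 : ℕ) +
      12 * ((n + w % 2) / 2 - ((w + 1) / 3 + w % 2) / 2 : ℕ) +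
      24 * (n - w / 3 : ℕ) - 12 * (if w % 5 = 0 then 1 else 0) := by
  have h : ∀ r ∈ Finset.Ico 1 (n + 1), interiorCount (w - r) r =
      ((r : ℤ) - 1) * (w - r - 5) + ((w / 3 : ℕ) - 1) * (if w = 3 * r then 1 else 0) +
      2 * (if r % 2 = 0 then 1 else 0) + 2 * (if r % 2 = w % 2 ∧ w + 2 ≤ 3 * r then 1 else 0) +
      4 * (if w + 1 ≤ 3 * r then 1 else 0) - 2 * (if 2 * w = 5 * r then 1 else 0) := by
    intro r hr
    rw [Finset.mem_Ico] at hr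
    rw [interiorCount, Nat.cast_sub (by omega)]
    simp only [show w - r = 2 * r ↔ w = 3 * r by omega,
      show ((w - r) % 2 = 0 ∧ w - r + 2 ≤ 2 * r) ↔ (r % 2 = w % 2 ∧ w + 2 ≤ 3 * r) by omega,
      show w - r + 1 ≤ 2 * r ↔ w + 1 ≤ 3 * r by omega,
      show 2 * (w - r) = 3 * r ↔ 2 * w = 5 * r by omega]
    by_cases h3 : w = 3 * r
    · have : w / 3 = r := by omega
      rw [if_pos h3, this]
      ring
    · rw [if_neg h3]
      ring
  rw [Finset.sum_congr rfl h]
  simp only [Finset.sum_add_distrib, Finset.sum_sub_distrib, ← Finset.mul_sum]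
  rw [sum_indicator_even, sum_indicator_same_parity,
    sum_indicator_lower,
    sum_indicator_unique (P := fun r => w = 3 * r) (Q := w % 3 = 0) (w / 3)
      (by simp only [Finset.mem_Ico]; omega) (by simp only [Finset.mem_Ico]; omega),
    sum_indicator_unique (P := fun r => 2 * w = 5 * r) (Q := w % 5 = 0) (2 * w / 5)
      (by simp only [Finset.mem_Ico]; omega) (by simp only [Finset.mem_Ico]; omega)]
  have h3 : 6 * (((w / 3 : ℕ) - 1 : ℤ) * (if w % 3 = 0 then 1 else 0)) =
      2 * (w - 3) * (if w % 3 = 0 then 1 else 0) := by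
    split_ifs with h3
    · have : (w : ℤ) = 3 * (w / 3 : ℕ) := by omega
      rw [this]
      push_cast
      ring
    · ring
  linear_combination sum_interior_polynomial w n + h3

lemma six_mul_card_normalTriples {w n : ℕ} (hw : 0 < w) (hn : n = (w - 1) / 2) :
    6 * ((normalTriples w).card : ℤ) =
      6 * (w - 1) + 6 * (2 * n * (w - 3) - n * (n + 1) + 2 * (if w % 3 = 0 then 1 else 0)) +
      ((-n * (n + 1) * (2 * n + 1) + 3 * (w - 4) * n * (n + 1) - 6 * (w - 5) * n) +
      2 * (w - 3) * (if w % 3 = 0 then 1 else 0) + 12 * (n / 2 : ℕ) +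
      12 * ((n + w % 2) / 2 - ((w + 1) / 3 + w % 2) / 2 : ℕ) +
      24 * (n - w / 3 : ℕ) - 12 * (if w % 5 = 0 then 1 else 0)) := by
  have hn' : (w + 1) / 2 = n + 1 := by omega
  rw [card_normalTriples hw, hn', ← six_mul_sum_interiorCount hw hn,
    ← two_mul_sum_edgeCount hw hn, Finset.sum_add_distrib, ← Finset.mul_sum]
  ring

lemma rangeCount_eq {w n : ℕ} (hw : 0 < w) (hn : n = (w - 1) / 2) :
    (rangeCount w : ℤ) =
      12 * (w - 1) + 36 * (2 * n * (w - 3) - n * (n + 1) + 2 * (if w % 3 = 0 then 1 else 0)) +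
      12 * ((-n * (n + 1) * (2 * n + 1) + 3 * (w - 4) * n * (n + 1) - 6 * (w - 5) * n) +
      2 * (w - 3) * (if w % 3 = 0 then 1 else 0) + 12 * (n / 2 : ℕ) +
      12 * ((n + w % 2) / 2 - ((w + 1) / 3 + w % 2) / 2 : ℕ) +
      24 * (n - w / 3 : ℕ) - 12 * (if w % 5 = 0 then 1 else 0)) - 36 * (n * (n - 1)) := by
  have hn' : (w + 1) / 2 = n + 1 := by omega
  have hsum : 2 * ∑ r ∈ Finset.Ico 1 (n + 1), ((r : ℤ) - 1) = n * (n - 1) := by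
    clear hn hn'
    induction n with
    | zero => simp
    | succ n ih =>
      rw [Finset.sum_Ico_succ_top (by omega), mul_add, ih]
      push_cast
      ring
  rw [rangeCount_eq_sum hw, hn', ← six_mul_sum_interiorCount hw hn,
    ← two_mul_sum_edgeCount hw hn, ← hsum, Finset.sum_add_distrib, ← Finset.mul_sum,
    ← Finset.mul_sum, Finset.sum_sub_distrib]
  ring

/-! ### Second differences of the stated quasipolynomials -/

/-- The value at `t` of the stated quasipolynomial for the number of squares. -/
def magilatinValue (t : ℕ) : ℚ :=
  3 / 10 * t ^ 5 - 51 / 8 * t ^ 4 + 202 / 3 * t ^ 3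
    - (if t % 2 = 0 then 3769 / 10 else 7493 / 20) * t ^ 2 + magilatinC1 t * t - magilatinC0 t

/-- The value at `t` of the stated quasipolynomial for the number of symmetry types. -/
def magilatinTypeValue (t : ℕ) : ℚ :=
  1 / 240 * t ^ 5 - 3 / 64 * t ^ 4 + 97 / 216 * t ^ 3
    - (if t % 2 = 0 then 2029 / 720 else 4013 / 1440) * t ^ 2
    + magilatinTypeC1 t * t - magilatinTypeC0 t

lemma magilatinC1_periodic : Function.Periodic magilatinC1 6 := by
  intro t; simp [magilatinC1]

lemma magilatinC0_periodic : Function.Periodic magilatinC0 60 := by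
  intro t; simp only [magilatinC0, Nat.add_mod_right]

lemma magilatinTypeC1_periodic : Function.Periodic magilatinTypeC1 6 := by
  intro t; simp [magilatinTypeC1]

lemma magilatinTypeC0_periodic : Function.Periodic magilatinTypeC0 60 := by
  intro t; simp only [magilatinTypeC0, Nat.add_mod_right]

lemma eq_of_mod_eq {c : ℕ → ℚ} {p a b : ℕ} (hc : Function.Periodic c p) (h : a % p = b % p) :
    c a = c b := by
  rw [← hc.map_mod_nat a, ← hc.map_mod_nat b, h]

/-- The difference is not truncated at `j`, which lets the multiples of k be split off. -/
lemma parity_count_sub (k j : ℕ) (hj : 0 < j) (hj' : j ≤ 60) :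
    (30 * k + (j - 1) / 2 + j % 2) / 2 - (20 * k + (j + 1) / 3 + j % 2) / 2 =
      5 * k + (((j - 1) / 2 + j % 2) / 2 - ((j + 1) / 3 + j % 2) / 2) := by
  have h : ((j + 1) / 3 + j % 2) / 2 ≤ ((j - 1) / 2 + j % 2) / 2 := by
    interval_cases j <;> decide
  omega

/-- The second difference of a stated quasipolynomial minus the formula for the reduced count,
at `60 * x + j`. The values `e`, `c`, `d` are those of the periodic coefficients. -/
def secondDifferenceDefect (a₅ a₄ a₃ b₁ b₂ b₃ b₄ j e₀ e₁ c₀ c₁ c₂ d₀ d₁ d₂ n h₃ h₅ m₁ m₂ m₃ x : ℚ) :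
    ℚ :=
  (a₅ * (60 * x + j + 2) ^ 5 - a₄ * (60 * x + j + 2) ^ 4 + a₃ * (60 * x + j + 2) ^ 3
    - e₀ * (60 * x + j + 2) ^ 2 + c₂ * (60 * x + j + 2) - d₂)
  - 2 * (a₅ * (60 * x + j + 1) ^ 5 - a₄ * (60 * x + j + 1) ^ 4 + a₃ * (60 * x + j + 1) ^ 3
    - e₁ * (60 * x + j + 1) ^ 2 + c₁ * (60 * x + j + 1) - d₁)
  + (a₅ * (60 * x + j) ^ 5 - a₄ * (60 * x + j) ^ 4 + a₃ * (60 * x + j) ^ 3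
    - e₀ * (60 * x + j) ^ 2 + c₀ * (60 * x + j) - d₀)
  - (b₁ * (60 * x + j - 1) + b₂ * (2 * (30 * x + n) * (60 * x + j - 3)
      - (30 * x + n) * (30 * x + n + 1) + 2 * h₃)
    + b₃ * (-(30 * x + n) * (30 * x + n + 1) * (2 * (30 * x + n) + 1)
      + 3 * (60 * x + j - 4) * (30 * x + n) * (30 * x + n + 1)
      - 6 * (60 * x + j - 5) * (30 * x + n) + 2 * (60 * x + j - 3) * h₃ + 12 * (15 * x + m₁)
      + 12 * (5 * x + m₂) + 24 * (10 * x + m₃) - 12 * h₅)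
    - b₄ * ((30 * x + n) * (30 * x + n - 1)))

/-- The defect has degree at most 3 in x, because taking second differences lowers the quintic to a
cubic and the reduced count is a cubic. Lagrange interpolation at 0, 1, 2, 3 finishes. -/
lemma secondDifferenceDefect_eq_zero
    {a₅ a₄ a₃ b₁ b₂ b₃ b₄ j e₀ e₁ c₀ c₁ c₂ d₀ d₁ d₂ n h₃ h₅ m₁ m₂ m₃ : ℚ}
    (h : ∀ i < 4, secondDifferenceDefect a₅ a₄ a₃ b₁ b₂ b₃ b₄ j e₀ e₁ c₀ c₁ c₂ d₀ d₁ d₂ n h₃ h₅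
      m₁ m₂ m₃ (i : ℕ) = 0) (x : ℚ) :
    secondDifferenceDefect a₅ a₄ a₃ b₁ b₂ b₃ b₄ j e₀ e₁ c₀ c₁ c₂ d₀ d₁ d₂ n h₃ h₅ m₁ m₂ m₃ x
      = 0 := by
  have h0 := h 0 (by norm_num)
  have h1 := h 1 (by norm_num)
  have h2 := h 2 (by norm_num)
  have h3 := h 3 (by norm_num)
  push_cast at h0 h1 h2 h3
  unfold secondDifferenceDefect at *
  linear_combination (-(x - 1) * (x - 2) * (x - 3) / 6) * h0 + (x * (x - 2) * (x - 3) / 2) * h1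
    - (x * (x - 1) * (x - 3) / 2) * h2 + (x * (x - 1) * (x - 2) / 6) * h3

lemma magilatin_defect_nodes : ∀ j < 61, 0 < j → ∀ i < 4, secondDifferenceDefect
    (3 / 10) (51 / 8) (202 / 3) 12 36 12 36 (j : ℕ)
    (if j % 2 = 0 then 3769 / 10 else 7493 / 20) (if (j + 1) % 2 = 0 then 3769 / 10 else 7493 / 20)
    (magilatinC1 j) (magilatinC1 (j + 1)) (magilatinC1 (j + 2))
    (magilatinC0 j) (magilatinC0 (j + 1)) (magilatinC0 (j + 2))
    ((j - 1) / 2 : ℕ) (if j % 3 = 0 then 1 else 0) (if j % 5 = 0 then 1 else 0)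
    ((j - 1) / 2 / 2 : ℕ) (((j - 1) / 2 + j % 2) / 2 - ((j + 1) / 3 + j % 2) / 2 : ℕ)
    ((j - 1) / 2 - j / 3 : ℕ) (i : ℕ) = 0 := by
  decide +kernel

lemma magilatinType_defect_nodes : ∀ j < 61, 0 < j → ∀ i < 4, secondDifferenceDefect
    (1 / 240) (3 / 64) (97 / 216) 1 1 (1 / 6) 0 (j : ℕ)
    (if j % 2 = 0 then 2029 / 720 else 4013 / 1440)
    (if (j + 1) % 2 = 0 then 2029 / 720 else 4013 / 1440)
    (magilatinTypeC1 j) (magilatinTypeC1 (j + 1)) (magilatinTypeC1 (j + 2))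
    (magilatinTypeC0 j) (magilatinTypeC0 (j + 1)) (magilatinTypeC0 (j + 2))
    ((j - 1) / 2 : ℕ) (if j % 3 = 0 then 1 else 0) (if j % 5 = 0 then 1 else 0)
    ((j - 1) / 2 / 2 : ℕ) (((j - 1) / 2 + j % 2) / 2 - ((j + 1) / 3 + j % 2) / 2 : ℕ)
    ((j - 1) / 2 - j / 3 : ℕ) (i : ℕ) = 0 := by
  decide +kernel

lemma magilatinValue_second_difference {w : ℕ} (hw : 0 < w) :
    magilatinValue (w + 2) - 2 * magilatinValue (w + 1) + magilatinValue w = rangeCount w := by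
  have key := congrArg (Int.cast : ℤ → ℚ) (rangeCount_eq hw rfl)
  -- Residues are taken in 1, ..., 60 so that (w - 1) / 2 = 30k + (j - 1) / 2 holds with truncated
  -- subtraction.
  obtain ⟨k, j, hj, hj', rfl⟩ : ∃ k j, 0 < j ∧ j ≤ 60 ∧ w = 60 * k + j :=
    ⟨(w - 1) / 60, (w - 1) % 60 + 1, by omega, by omega, by omega⟩
  rw [show (60 * k + j - 1) / 2 = 30 * k + (j - 1) / 2 by omega,
    show (60 * k + j) / 3 = 20 * k + j / 3 by omega,
    show (60 * k + j + 1) / 3 = 20 * k + (j + 1) / 3 by omega,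
    show (60 * k + j) % 2 = j % 2 by omega,
    show (60 * k + j) % 3 = j % 3 by omega,
    show (60 * k + j) % 5 = j % 5 by omega,
    show (30 * k + (j - 1) / 2) / 2 = 15 * k + (j - 1) / 2 / 2 by omega,
    parity_count_sub k j hj hj',
    show 30 * k + (j - 1) / 2 - (20 * k + j / 3) = 10 * k + ((j - 1) / 2 - j / 3) by omega] at key
  have h := secondDifferenceDefect_eq_zero (magilatin_defect_nodes j (by omega) hj) k
  simp only [magilatinValue, show (60 * k + j + 2) % 2 = j % 2 by omega,
    show (60 * k + j + 1) % 2 = (j + 1) % 2 by omega, show (60 * k + j) % 2 = j % 2 by omega]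
  rw [eq_of_mod_eq magilatinC1_periodic (show (60 * k + j + 2) % 6 = (j + 2) % 6 by omega),
    eq_of_mod_eq magilatinC1_periodic (show (60 * k + j + 1) % 6 = (j + 1) % 6 by omega),
    eq_of_mod_eq magilatinC1_periodic (show (60 * k + j) % 6 = j % 6 by omega),
    eq_of_mod_eq magilatinC0_periodic (show (60 * k + j + 2) % 60 = (j + 2) % 60 by omega),
    eq_of_mod_eq magilatinC0_periodic (show (60 * k + j + 1) % 60 = (j + 1) % 60 by omega),
    eq_of_mod_eq magilatinC0_periodic (show (60 * k + j) % 60 = j % 60 by omega)]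
  unfold secondDifferenceDefect at h
  generalize ((j - 1) / 2 + j % 2) / 2 - ((j + 1) / 3 + j % 2) / 2 = m₂ at key h
  generalize (j - 1) / 2 - j / 3 = m₃ at key h
  generalize (j - 1) / 2 / 2 = m₁ at key h
  generalize (j - 1) / 2 = n at key h
  push_cast at key ⊢
  linear_combination h - key

lemma magilatinTypeValue_second_difference {w : ℕ} (hw : 0 < w) :
    magilatinTypeValue (w + 2) - 2 * magilatinTypeValue (w + 1) + magilatinTypeValue w = (normalTriples w).card := by
  have key := congrArg (Int.cast : ℤ → ℚ) (six_mul_card_normalTriples hw rfl)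
  obtain ⟨k, j, hj, hj', rfl⟩ : ∃ k j, 0 < j ∧ j ≤ 60 ∧ w = 60 * k + j :=
    ⟨(w - 1) / 60, (w - 1) % 60 + 1, by omega, by omega, by omega⟩
  rw [show (60 * k + j - 1) / 2 = 30 * k + (j - 1) / 2 by omega,
    show (60 * k + j) / 3 = 20 * k + j / 3 by omega,
    show (60 * k + j + 1) / 3 = 20 * k + (j + 1) / 3 by omega,
    show (60 * k + j) % 2 = j % 2 by omega,
    show (60 * k + j) % 3 = j % 3 by omega,
    show (60 * k + j) % 5 = j % 5 by omega,
    show (30 * k + (j - 1) / 2) / 2 = 15 * k + (j - 1) / 2 / 2 by omega,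
    parity_count_sub k j hj hj',
    show 30 * k + (j - 1) / 2 - (20 * k + j / 3) = 10 * k + ((j - 1) / 2 - j / 3) by omega] at key
  have h := secondDifferenceDefect_eq_zero (magilatinType_defect_nodes j (by omega) hj) k
  simp only [magilatinTypeValue, show (60 * k + j + 2) % 2 = j % 2 by omega,
    show (60 * k + j + 1) % 2 = (j + 1) % 2 by omega, show (60 * k + j) % 2 = j % 2 by omega]
  rw [eq_of_mod_eq magilatinTypeC1_periodic (show (60 * k + j + 2) % 6 = (j + 2) % 6 by omega),
    eq_of_mod_eq magilatinTypeC1_periodic (show (60 * k + j + 1) % 6 = (j + 1) % 6 by omega),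
    eq_of_mod_eq magilatinTypeC1_periodic (show (60 * k + j) % 6 = j % 6 by omega),
    eq_of_mod_eq magilatinTypeC0_periodic (show (60 * k + j + 2) % 60 = (j + 2) % 60 by omega),
    eq_of_mod_eq magilatinTypeC0_periodic (show (60 * k + j + 1) % 60 = (j + 1) % 60 by omega),
    eq_of_mod_eq magilatinTypeC0_periodic (show (60 * k + j) % 60 = j % 60 by omega)]
  unfold secondDifferenceDefect at h
  generalize ((j - 1) / 2 + j % 2) / 2 - ((j + 1) / 3 + j % 2) / 2 = m₂ at key h
  generalize (j - 1) / 2 - j / 3 = m₃ at key h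
  generalize (j - 1) / 2 / 2 = m₁ at key h
  generalize (j - 1) / 2 = n at key h
  push_cast at key ⊢
  linear_combination h - key / 6

/-! ### The linear recurrence of order 19 -/

/-- A function of a natural number that is given by a polynomial of degree at most `d`. -/
def IsPolynomialOfDegreeLE (d : ℕ) (f : ℕ → ℚ) : Prop :=
  ∃ P : Polynomial ℚ, P.natDegree ≤ d ∧ ∀ k : ℕ, f k = P.eval (k : ℚ)

lemma IsPolynomialOfDegreeLE.sum_smul {ι : Type*} {d : ℕ} (s : Finset ι) (a : ι → ℚ)
    {f : ι → ℕ → ℚ} (h : ∀ i, IsPolynomialOfDegreeLE d (f i)) :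
    IsPolynomialOfDegreeLE d (fun k => ∑ i ∈ s, a i * f i k) := by
  choose P hP hf using h
  refine ⟨∑ i ∈ s, Polynomial.C (a i) * P i, ?_, fun k => ?_⟩
  · exact Polynomial.natDegree_sum_le_of_forall_le _ _
      fun i _ => (Polynomial.natDegree_C_mul_le _ _).trans (hP i)
  · simp [Polynomial.eval_finsetSum, hf]

lemma IsPolynomialOfDegreeLE.eq_zero {d : ℕ} {f : ℕ → ℚ} (h : IsPolynomialOfDegreeLE d f)
    (h0 : ∀ i < d + 1, f i = 0) (k : ℕ) : f k = 0 := by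
  obtain ⟨P, hP, hf⟩ := h
  have : P = 0 := by
    refine Polynomial.eq_zero_of_natDegree_lt_card_of_eval_eq_zero P
      (f := fun i : Fin (d + 1) => ((i : ℕ) : ℚ)) ?_ ?_ ?_
    · intro i j hij
      exact Fin.ext (by simpa using hij)
    · intro i
      rw [← hf, h0 i i.2]
    · rw [Fintype.card_fin]
      omega
  rw [hf, this, Polynomial.eval_zero]

lemma isPolynomialOfDegreeLE_quintic (a₅ a₄ a₃ a₂ a₁ a₀ m : ℚ) :
    IsPolynomialOfDegreeLE 5 (fun k => a₅ * (60 * k + m) ^ 5 - a₄ * (60 * k + m) ^ 4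
      + a₃ * (60 * k + m) ^ 3 - a₂ * (60 * k + m) ^ 2 + a₁ * (60 * k + m) - a₀) := by
  open Polynomial in
  refine ⟨C a₅ * (60 * X + C m) ^ 5 - C a₄ * (60 * X + C m) ^ 4
      + C a₃ * (60 * X + C m) ^ 3 - C a₂ * (60 * X + C m) ^ 2 + C a₁ * (60 * X + C m) - C a₀,
      ?_, fun k => ?_⟩
  · compute_degree
  · simp

lemma magilatinValue_isPolynomialOfDegreeLE (m : ℕ) :
    IsPolynomialOfDegreeLE 5 (fun k => magilatinValue (60 * k + m)) := by
  convert isPolynomialOfDegreeLE_quintic (3 / 10) (51 / 8) (202 / 3)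
    (if m % 2 = 0 then 3769 / 10 else 7493 / 20) (magilatinC1 m) (magilatinC0 m) m using 2 with k
  rw [magilatinValue, eq_of_mod_eq magilatinC1_periodic (show (60 * k + m) % 6 = m % 6 by omega),
    eq_of_mod_eq magilatinC0_periodic (show (60 * k + m) % 60 = m % 60 by omega),
    show (60 * k + m) % 2 = m % 2 by omega]
  push_cast
  rfl

lemma magilatinTypeValue_isPolynomialOfDegreeLE (m : ℕ) :
    IsPolynomialOfDegreeLE 5 (fun k => magilatinTypeValue (60 * k + m)) := by
  convert isPolynomialOfDegreeLE_quintic (1 / 240) (3 / 64) (97 / 216)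
    (if m % 2 = 0 then 2029 / 720 else 4013 / 1440) (magilatinTypeC1 m) (magilatinTypeC0 m) m
    using 2 with k
  rw [magilatinTypeValue,
    eq_of_mod_eq magilatinTypeC1_periodic (show (60 * k + m) % 6 = m % 6 by omega),
    eq_of_mod_eq magilatinTypeC0_periodic (show (60 * k + m) % 60 = m % 60 by omega),
    show (60 * k + m) % 2 = m % 2 by omega]
  push_cast
  rfl

/-- The coefficients of `(1 - x²)² (1 - x³)² (1 - x⁴) (1 - x⁵)`. -/
def denominatorCoeff (i : ℕ) : ℚ :=
  ([1, 0, -2, -2, 0, 3, 3, 2, -1, -4, -4, -1, 2, 3, 3, 0, -2, -2, 0, 1] : List ℚ).getD i 0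

/-- Along each residue class modulo 60 the left side is a polynomial of degree at most 5 in k, so
six zeros make it vanish. -/
lemma recurrence_of_nodes {V : ℕ → ℚ} (hV : ∀ m, IsPolynomialOfDegreeLE 5 fun k => V (60 * k + m))
    (h : ∀ j < 60, ∀ i < 6,
      ∑ l ∈ Finset.range 20, denominatorCoeff l * V (60 * i + (j + (19 - l))) = 0) (n : ℕ) :
    ∑ l ∈ Finset.range 20, denominatorCoeff l * V (n + (19 - l)) = 0 := by
  have := (IsPolynomialOfDegreeLE.sum_smul (Finset.range 20) denominatorCoeff
    (f := fun l k => V (60 * k + (n % 60 + (19 - l)))) fun l => hV _).eq_zero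
    (h (n % 60) (Nat.mod_lt _ (by norm_num))) (n / 60)
  simpa only [← add_assoc, Nat.div_add_mod] using this

lemma magilatinValue_recurrence (n : ℕ) :
    ∑ l ∈ Finset.range 20, denominatorCoeff l * magilatinValue (n + (19 - l)) = 0 := by
  refine recurrence_of_nodes magilatinValue_isPolynomialOfDegreeLE ?_ n
  decide +kernel

lemma magilatinTypeValue_recurrence (n : ℕ) :
    ∑ l ∈ Finset.range 20, denominatorCoeff l * magilatinTypeValue (n + (19 - l)) = 0 := by
  refine recurrence_of_nodes magilatinTypeValue_isPolynomialOfDegreeLE ?_ n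
  decide +kernel

/-! ### The counts equal the stated values -/

lemma normalTriples_zero : normalTriples 0 = ∅ := by
  rw [Finset.eq_empty_iff_forall_notMem]
  intro x hx
  have := (mem_normalTriples.1 hx).2.2.1
  omega

/-- Both sequences satisfy the same second-order recurrence from t = 1 on. The sum gives N 1 = 0 and
N 2 = R 0 = 0, matching `h1` and `h2`. -/
lemma eq_value_of_second_difference {N R : ℕ → ℕ} {V : ℕ → ℚ}
    (hN : ∀ t, N t = ∑ w ∈ Finset.range t, (t - 1 - w) * R w) (hR : R 0 = 0)
    (h1 : V 1 = 0) (h2 : V 2 = 0)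
    (hV : ∀ w, 0 < w → V (w + 2) - 2 * V (w + 1) + V w = R w) (t : ℕ) (ht : 0 < t) :
    (N t : ℚ) = V t := by
  have key : ∀ t, (N (t + 1) : ℚ) = V (t + 1) ∧ (N (t + 2) : ℚ) = V (t + 2) := by
    intro t
    induction t with
    | zero => simp [hN, h1, h2, hR, Finset.sum_range_succ]
    | succ t ih =>
      refine ⟨ih.2, ?_⟩
      have h := sum_range_weighted_second_difference R (t + 1)
      rw [← hN, ← hN, ← hN] at h
      have h' := congrArg (Nat.cast : ℕ → ℚ) h
      push_cast at h'
      have hv := hV (t + 1) (Nat.succ_pos t)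
      have i1 := ih.1
      have i2 := ih.2
      change (N (t + 1 + 1) : ℚ) = V (t + 1 + 1) at i2
      linarith
  obtain ⟨s, rfl⟩ := Nat.exists_eq_succ_of_ne_zero ht.ne'
  exact (key s).1

lemma magilatinCount_eq_value (t : ℕ) (ht : 0 < t) : (magilatinCount t : ℚ) = magilatinValue t :=
  eq_value_of_second_difference magilatinCount_eq
    (by rw [reducedMagilatinCount_eq, rangeCount, normalTriples_zero, Finset.sum_empty])
    (by decide +kernel) (by decide +kernel)
    (fun w hw => by rw [magilatinValue_second_difference hw, reducedMagilatinCount_eq]) t ht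

lemma magilatinTypeCount_eq_value (t : ℕ) (ht : 0 < t) :
    (magilatinTypeCount t : ℚ) = magilatinTypeValue t :=
  eq_value_of_second_difference magilatinTypeCount_eq
    (by rw [reducedMagilatinTypeCount_eq, normalTriples_zero, Finset.card_empty])
    (by decide +kernel) (by decide +kernel)
    (fun w hw => by
      rw [magilatinTypeValue_second_difference hw, reducedMagilatinTypeCount_eq]) t ht

lemma magilatinCount_hasConstituents :
    HasConstituents magilatinCount 60 magilatinConstituent := by
  refine ⟨by norm_num, fun t ht => ?_⟩
  rw [magilatinCount_eq_value t ht]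
  simp [magilatinConstituent, magilatinValue, magilatinC1, magilatinC0, Nat.even_iff,
    Nat.mod_mod_of_dvd]

lemma magilatinTypeCount_hasConstituents :
    HasConstituents magilatinTypeCount 60 magilatinTypeConstituent := by
  refine ⟨by norm_num, fun t ht => ?_⟩
  rw [magilatinTypeCount_eq_value t ht]
  simp [magilatinTypeConstituent, magilatinTypeValue, magilatinTypeC1, magilatinTypeC0,
    Nat.even_iff, Nat.mod_mod_of_dvd]

lemma natDegree_magilatinConstituent (r : ℕ) : (magilatinConstituent r).natDegree = 5 := by
  unfold magilatinConstituent
  compute_degree!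

lemma natDegree_magilatinTypeConstituent (r : ℕ) :
    (magilatinTypeConstituent r).natDegree = 5 := by
  unfold magilatinTypeConstituent
  compute_degree!

/-! ### Least periods -/

lemma hasMinimalPeriod_of_forall_lt {c : ℕ → ℚ} {p : ℕ} (hp : 0 < p)
    (hc : Function.Periodic c p) (h : ∀ q < p, 0 < q → ∃ j < p, c (j + q) ≠ c j) :
    HasMinimalPeriod c p := by
  refine ⟨⟨hp, hc⟩, fun q hq => ?_⟩
  by_contra hlt
  obtain ⟨j, -, hj⟩ := h q (not_le.1 hlt) hq.1
  exact hj (hq.2 j)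

lemma hasMinimalPeriod_magilatinC1 : HasMinimalPeriod magilatinC1 6 :=
  hasMinimalPeriod_of_forall_lt (by norm_num) magilatinC1_periodic (by decide +kernel)

lemma hasMinimalPeriod_magilatinC0 : HasMinimalPeriod magilatinC0 60 :=
  hasMinimalPeriod_of_forall_lt (by norm_num) magilatinC0_periodic (by decide +kernel)

lemma hasMinimalPeriod_magilatinTypeC1 : HasMinimalPeriod magilatinTypeC1 6 :=
  hasMinimalPeriod_of_forall_lt (by norm_num) magilatinTypeC1_periodic (by decide +kernel)

lemma hasMinimalPeriod_magilatinTypeC0 : HasMinimalPeriod magilatinTypeC0 60 :=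
  hasMinimalPeriod_of_forall_lt (by norm_num) magilatinTypeC0_periodic (by decide +kernel)

/-- Both polynomials give the values of N at the infinitely many points r + pq(n + 1), which are
positive even for r = 0. -/
lemma constituent_eq {N : ℕ → ℕ} {p q : ℕ} {P Q : ℕ → Polynomial ℚ}
    (hP : HasConstituents N p P) (hQ : HasConstituents N q Q) (r : ℕ) :
    P (r % p) = Q (r % q) := by
  have hpq : 0 < p * q := Nat.mul_pos hP.1 hQ.1
  refine Polynomial.eq_of_infinite_eval_eq _ _ (Set.infinite_of_injective_forall_mem
    (f := fun n : ℕ => ((r + p * q * (n + 1) : ℕ) : ℚ)) ?_ fun n => ?_)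
  · intro a b hab
    have h : r + p * q * (a + 1) = r + p * q * (b + 1) := Nat.cast_injective hab
    have := Nat.eq_of_mul_eq_mul_left hpq (Nat.add_left_cancel h)
    omega
  · have ht : 0 < r + p * q * (n + 1) := Nat.add_pos_right _ (Nat.mul_pos hpq n.succ_pos)
    have h1 := hP.2 _ ht
    have h2 := hQ.2 _ ht
    have e1 : (r + p * q * (n + 1)) % p = r % p := by
      rw [mul_assoc, Nat.add_mul_mod_self_left]
    have e2 : (r + p * q * (n + 1)) % q = r % q := by
      rw [mul_comm p q, mul_assoc, Nat.add_mul_mod_self_left]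
    rw [e1] at h1
    rw [e2] at h2
    exact h1.symm.trans h2

/-- If q constituents suffice, uniqueness makes the constituents, and so their constant terms,
q-periodic; hence the least period of c is at most q. -/
lemma isQuasiperiod_of_coeff_zero {N : ℕ → ℕ} {p : ℕ} {P : ℕ → Polynomial ℚ} {c : ℕ → ℚ}
    (hP : HasConstituents N p P) (hc : ∀ r, (P r).coeff 0 = -c r) (hmin : HasMinimalPeriod c p) :
    IsQuasiperiod N p := by
  refine ⟨⟨P, hP⟩, ?_⟩
  rintro q ⟨Q, hQ⟩
  refine hmin.2 ⟨hQ.1, fun r => ?_⟩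
  have h : P ((r + q) % p) = P (r % p) := by
    rw [constituent_eq hP hQ, constituent_eq hP hQ, Nat.add_mod_right]
  have h0 := congrArg (fun f : Polynomial ℚ => f.coeff 0) h
  simp only [hc, neg_inj] at h0
  rwa [hmin.1.2.map_mod_nat, hmin.1.2.map_mod_nat] at h0

lemma isQuasiperiod_magilatinCount : IsQuasiperiod magilatinCount 60 :=
  isQuasiperiod_of_coeff_zero magilatinCount_hasConstituents
    (fun r => by simp [magilatinConstituent]) hasMinimalPeriod_magilatinC0

lemma isQuasiperiod_magilatinTypeCount : IsQuasiperiod magilatinTypeCount 60 :=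
  isQuasiperiod_of_coeff_zero magilatinTypeCount_hasConstituents
    (fun r => by simp [magilatinTypeConstituent]) hasMinimalPeriod_magilatinTypeC0

/-! ### Generating functions -/

open PowerSeries in
lemma genFun_eq_of_second_difference {N R : ℕ → ℕ}
    (hN : ∀ t, N t = ∑ w ∈ Finset.range t, (t - 1 - w) * R w) (hR : R 0 = 0) :
    genFun N = X ^ 2 * ((1 - X) ^ 2)⁻¹ * genFun R := by
  have hcoeff : ∀ (M : ℕ → ℕ), M 0 = 0 → ∀ n, coeff n (genFun M) = (M n : ℚ) := by
    intro M hM n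
    rw [genFun, coeff_mk]
    split_ifs with h
    · rw [h, hM, Nat.cast_zero]
    · rfl
  have hN0 : N 0 = 0 := by simp [hN]
  rw [mul_right_comm, PowerSeries.eq_mul_inv_iff_mul_eq (by simp)]
  have hexp : genFun N * (1 - X) ^ 2 =
      genFun N - (2 : ℚ) • (X ^ 1 * genFun N) + X ^ 2 * genFun N := by
    rw [smul_eq_C_mul, map_ofNat]
    ring
  rw [hexp]
  ext n
  simp only [map_add, map_sub, map_smul, coeff_X_pow_mul', hcoeff N hN0, hcoeff R hR, smul_eq_mul]
  rcases n with _ | _ | n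
  · simp [hN0]
  · simp [hN]
  · have h := sum_range_weighted_second_difference R n
    rw [← hN, ← hN, ← hN] at h
    have h' := congrArg (Nat.cast : ℕ → ℚ) h
    push_cast at h'
    simp only [show 1 ≤ n + 1 + 1 by omega, show 2 ≤ n + 1 + 1 by omega, if_true,
      show n + 1 + 1 - 1 = n + 1 by omega, show n + 1 + 1 - 2 = n by omega]
    linarith

open PowerSeries in
lemma denominator_expansion :
    ((1 - X ^ 4) * (1 - X ^ 5) * (1 - X ^ 3) ^ 2 * (1 - X ^ 2) ^ 2 : PowerSeries ℚ) =
      ∑ l ∈ Finset.range 20, denominatorCoeff l • X ^ l := by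
  simp only [Finset.sum_range_succ, Finset.sum_range_zero, denominatorCoeff,
    List.getD_cons_succ, List.getD_cons_zero, smul_eq_C_mul, map_neg, map_one, map_zero,
    map_ofNat]
  ring

open PowerSeries in
lemma genFun_eq_of_recurrence {N : ℕ → ℕ} {V : ℕ → ℚ} {A : PowerSeries ℚ}
    (hNV : ∀ t, 0 < t → (N t : ℚ) = V t)
    (hV : ∀ n, ∑ l ∈ Finset.range 20, denominatorCoeff l * V (n + (19 - l)) = 0) {a : List ℚ}
    (hA : A = ∑ l ∈ Finset.range 20, a.getD l 0 • X ^ l)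
    (ha : ∀ n < 20, ∑ l ∈ Finset.range 20,
      (if l < n then denominatorCoeff l * V (n - l) else 0) = a.getD n 0) :
    genFun N = A * ((1 - X ^ 4) * (1 - X ^ 5) * (1 - X ^ 3) ^ 2 * (1 - X ^ 2) ^ 2)⁻¹ := by
  rw [PowerSeries.eq_mul_inv_iff_mul_eq (by simp), denominator_expansion, hA]
  ext n
  have hcoeff : coeff n (genFun N * ∑ l ∈ Finset.range 20, denominatorCoeff l • X ^ l) =
      ∑ l ∈ Finset.range 20, if l < n then denominatorCoeff l * V (n - l) else 0 := by
    rw [Finset.mul_sum, map_sum]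
    refine Finset.sum_congr rfl fun l _ => ?_
    rw [mul_smul_comm, map_smul, coeff_mul_X_pow', genFun, coeff_mk, smul_eq_mul]
    rcases lt_trichotomy l n with h | h | h
    · rw [if_pos h.le, if_pos h, if_neg (by omega), hNV _ (by omega)]
    · simp [h]
    · rw [if_neg (by omega), if_neg (by omega), mul_zero]
  rw [hcoeff, map_sum]
  simp only [map_smul, coeff_X_pow, smul_eq_mul, mul_ite, mul_one, mul_zero, Finset.sum_ite_eq,
    Finset.mem_range]
  split_ifs with h
  · exact ha n h
  -- Since n ≥ 20, every index n - l is positive. The value V 0, absent from the generating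
  -- function, therefore enters only the coefficients checked in `ha`.
  · rw [← hV (n - 19)]
    refine Finset.sum_congr rfl fun l hl => ?_
    rw [Finset.mem_range] at hl
    rw [if_pos (by omega), show n - l = n - 19 + (19 - l) by omega]

open PowerSeries in
lemma genFun_magilatinCount :
    genFun magilatinCount =
      12 * X ^ 4 *
        (79 * X ^ 15 + 190 * X ^ 14 + 260 * X ^ 13 + 250 * X ^ 12
        + 211 * X ^ 11 + 179 * X ^ 10 + 181 * X ^ 9 + 198 * X ^ 8
        + 210 * X ^ 7 + 181 * X ^ 6 + 125 * X ^ 5 + 61 * X ^ 4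
        + 22 * X ^ 3 + 8 * X ^ 2 + 4 * X + 1) *
        ((1 - X ^ 4) * (1 - X ^ 5) * (1 - X ^ 3) ^ 2 * (1 - X ^ 2) ^ 2)⁻¹ := by
  refine genFun_eq_of_recurrence magilatinCount_eq_value magilatinValue_recurrence
    -- The numerator reaches degree 19 because the term t = 0 is missing: its top coefficient 948 =
    -- 12 · 79 is -V 0, that is, c₀(0).
    (a := [0, 0, 0, 0, 12, 48, 96, 264, 732, 1500, 2172, 2520, 2376, 2172, 2148, 2532, 3000,
      3120, 2280, 948]) ?_ (by decide +kernel)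
  simp only [Finset.sum_range_succ, Finset.sum_range_zero, List.getD_cons_succ,
    List.getD_cons_zero, smul_eq_C_mul, map_zero, map_ofNat]
  ring

open PowerSeries in
lemma genFun_magilatinTypeCount :
    genFun magilatinTypeCount =
      X ^ 4 *
        (9 * X ^ 15 + 20 * X ^ 14 + 23 * X ^ 13 + 16 * X ^ 12
        + 10 * X ^ 11 + 13 * X ^ 10 + 27 * X ^ 9 + 43 * X ^ 8
        + 54 * X ^ 7 + 52 * X ^ 6 + 41 * X ^ 5 + 25 * X ^ 4
        + 14 * X ^ 3 + 8 * X ^ 2 + 4 * X + 1) *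
        ((1 - X ^ 4) * (1 - X ^ 5) * (1 - X ^ 3) ^ 2 * (1 - X ^ 2) ^ 2)⁻¹ := by
  refine genFun_eq_of_recurrence magilatinTypeCount_eq_value magilatinTypeValue_recurrence
    (a := [0, 0, 0, 0, 1, 4, 8, 14, 25, 41, 52, 54, 43, 27, 13, 10, 16, 23, 20, 9]) ?_
    (by decide +kernel)
  simp only [Finset.sum_range_succ, Finset.sum_range_zero, List.getD_cons_succ,
    List.getD_cons_zero, smul_eq_C_mul, map_zero, map_one, map_ofNat]
  ring

open PowerSeries in
theorem mainTheorem5 :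
    -- the generating function of the number of squares
    (genFun magilatinCount =
        X ^ 2 * ((1 - X) ^ 2)⁻¹ * genFun reducedMagilatinCount ∧
      genFun magilatinCount =
        12 * X ^ 4 *
          (79 * X ^ 15 + 190 * X ^ 14 + 260 * X ^ 13 + 250 * X ^ 12
          + 211 * X ^ 11 + 179 * X ^ 10 + 181 * X ^ 9 + 198 * X ^ 8
          + 210 * X ^ 7 + 181 * X ^ 6 + 125 * X ^ 5 + 61 * X ^ 4
          + 22 * X ^ 3 + 8 * X ^ 2 + 4 * X + 1) *
          ((1 - X ^ 4) * (1 - X ^ 5) * (1 - X ^ 3) ^ 2 * (1 - X ^ 2) ^ 2)⁻¹) ∧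
    -- the constituents, degree and period of the number of squares
    (HasConstituents magilatinCount 60 magilatinConstituent ∧
      (∀ r < 60, (magilatinConstituent r).natDegree = 5) ∧
      IsQuasiperiod magilatinCount 60 ∧
      HasMinimalPeriod magilatinC1 6 ∧ HasMinimalPeriod magilatinC0 60) ∧
    -- the generating function of the number of symmetry types
    (genFun magilatinTypeCount =
        X ^ 2 * ((1 - X) ^ 2)⁻¹ * genFun reducedMagilatinTypeCount ∧
      genFun magilatinTypeCount =
        X ^ 4 *
          (9 * X ^ 15 + 20 * X ^ 14 + 23 * X ^ 13 + 16 * X ^ 12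
          + 10 * X ^ 11 + 13 * X ^ 10 + 27 * X ^ 9 + 43 * X ^ 8
          + 54 * X ^ 7 + 52 * X ^ 6 + 41 * X ^ 5 + 25 * X ^ 4
          + 14 * X ^ 3 + 8 * X ^ 2 + 4 * X + 1) *
          ((1 - X ^ 4) * (1 - X ^ 5) * (1 - X ^ 3) ^ 2 * (1 - X ^ 2) ^ 2)⁻¹) ∧
    -- the constituents, degree and period of the number of symmetry types
    (HasConstituents magilatinTypeCount 60 magilatinTypeConstituent ∧
      (∀ r < 60, (magilatinTypeConstituent r).natDegree = 5) ∧
      IsQuasiperiod magilatinTypeCount 60 ∧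
      HasMinimalPeriod magilatinTypeC1 6 ∧ HasMinimalPeriod magilatinTypeC0 60) := by
  have hR : reducedMagilatinCount 0 = 0 := by
    rw [reducedMagilatinCount_eq, rangeCount, normalTriples_zero, Finset.sum_empty]
  have hT : reducedMagilatinTypeCount 0 = 0 := by
    rw [reducedMagilatinTypeCount_eq, normalTriples_zero, Finset.card_empty]
  exact ⟨⟨genFun_eq_of_second_difference magilatinCount_eq hR, genFun_magilatinCount⟩,
    ⟨magilatinCount_hasConstituents, fun r _ => natDegree_magilatinConstituent r,
      isQuasiperiod_magilatinCount, hasMinimalPeriod_magilatinC1, hasMinimalPeriod_magilatinC0⟩,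
    ⟨genFun_eq_of_second_difference magilatinTypeCount_eq hT, genFun_magilatinTypeCount⟩,
    ⟨magilatinTypeCount_hasConstituents, fun r _ => natDegree_magilatinTypeConstituent r,
      isQuasiperiod_magilatinTypeCount, hasMinimalPeriod_magilatinTypeC1,
      hasMinimalPeriod_magilatinTypeC0⟩⟩
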